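/- Let $h\in\mathbb{R}[x_1,\dots,x_n]$ be a homogeneous polynomial that is hyperbolic with respect to $\mathbf{e}\in\mathbb{R}^n$, i.e. $h(\mathbf{e})\neq 0$ and for every $\mathbf{x}\in\mathbb{R}^n$ the polynomial $t\mapsto h(t\mathbf{e}-\mathbf{x})$ has only real zeros. The zeros (with multiplicity) are called the eigenvalues of $\mathbf{x}$, the number of non-zero ones is the hyperbolic rank $\mathrm{rk}(\mathbf{x})$, and the hyperbolicity cone $\Lambda_+=\Lambda_+(h,\mathbf{e})$ is the set of all $\mathbf{x}$ whose eigenvalues are all nonnegative. A projection is an element of $\Lambda_+$ whose eigenvalues all lie in $\{0,1\}$. A face of $\Lambda_+$ is a convex subcone $F\subseteq\Lambda_+$ containing $\mathbf{0}$ such that $\mathbf{x},\mathbf{y},\mathbf{y}-\mathbf{x}\in\Lambda_+$ and $\mathbf{y}\in F$ imply $\mathbf{x}\in F$; its hyperbolic rank is $\mathrm{rk}(F)=\max_{\mathbf{x}\in F}\mathrm{rk}(\mathbf{x})$. An extreme ray is a face of the form $\{r\mathbf{v}: r\ge 0\}$ with $\mathbf{v}\neq\mathbf{0}$. Suppose that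 $\Lambda_+\cap(-\Lambda_+)=\{\mathbf{0}\}$, that all extreme rays of $\Lambda_+$ have the same hyperbolic rank, and that each face of $\Lambda_+$ contains a projection in its relative interior. Then the set $L(\Lambda_+)$ of all faces of $\Lambda_+$, ordered by containment, is a modular geometric lattice, i.e. it is a lattice of finite length in which every element is a join of atoms, and which is modular (in particular semimodular). -/

import Mathlib

noncomputable section

namespace Hyperbolic

variable {n : ℕ}

/-- The univariate polynomial `t ↦ h (t e - x)`. -/
def linePoly (h : MvPolynomial (Fin n) ℝ) (e x : Fin n → ℝ) : Polynomial ℝ :=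
  MvPolynomial.aeval (fun i => Polynomial.X * Polynomial.C (e i) - Polynomial.C (x i)) h

/-- The homogeneous polynomial `h` is hyperbolic with respect to `e`: `h e ≠ 0`, and for every `x`
the polynomial `t ↦ h (t e - x)` has only real zeros, i.e. splits into linear factors over `ℝ`. -/
structure IsHyperbolic (h : MvPolynomial (Fin n) ℝ) (e : Fin n → ℝ) : Prop where
  homogeneous : ∃ d : ℕ, h.IsHomogeneous d
  eval_ne_zero : MvPolynomial.eval e h ≠ 0
  splits : ∀ x : Fin n → ℝ, (linePoly h e x).Splits

/-- The eigenvalues of `x` with respect to `e`, with multiplicity: the zeros of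
`t ↦ h (t e - x)`. -/
def eigenvalues (h : MvPolynomial (Fin n) ℝ) (e x : Fin n → ℝ) : Multiset ℝ :=
  (linePoly h e x).roots

/-- The hyperbolicity cone `Λ₊(h, e)`: all vectors whose eigenvalues are nonnegative. -/
def hyperbolicityCone (h : MvPolynomial (Fin n) ℝ) (e : Fin n → ℝ) : Set (Fin n → ℝ) :=
  {x | ∀ t ∈ eigenvalues h e x, 0 ≤ t}

/-- The hyperbolic rank: the number of non-zero eigenvalues, counted with multiplicity. -/
def hypRank (h : MvPolynomial (Fin n) ℝ) (e x : Fin n → ℝ) : ℕ :=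
  ((eigenvalues h e x).filter (fun t => t ≠ 0)).card

/-- A projection is an element of the hyperbolicity cone with eigenvalues in `{0, 1}`. -/
def IsProjection (h : MvPolynomial (Fin n) ℝ) (e x : Fin n → ℝ) : Prop :=
  x ∈ hyperbolicityCone h e ∧ ∀ t ∈ eigenvalues h e x, t = 0 ∨ t = 1

/-- The lineality space `C ∩ -C` of a convex cone `C`. -/
def linealitySpace (C : Set (Fin n → ℝ)) : Set (Fin n → ℝ) :=
  {x | x ∈ C ∧ -x ∈ C}

/-- A face of `C`: a convex subcone `F` (containing `0`) such that `y ∈ F` implies `x ∈ F` whenever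
`x ≤ y`, that is, `x`, `y` and `y - x` lie in `C`. -/
structure IsFace (C : Set (Fin n → ℝ)) (F : PointedCone ℝ (Fin n → ℝ)) : Prop where
  subset : (F : Set (Fin n → ℝ)) ⊆ C
  mem_of_le : ∀ x y : Fin n → ℝ, x ∈ C → y ∈ C → y - x ∈ C → y ∈ F → x ∈ F

/-- The collection of faces of `C`, ordered by containment. -/
abbrev Faces (C : Set (Fin n → ℝ)) : Type :=
  {F : PointedCone ℝ (Fin n → ℝ) // IsFace C F}

/-- The hyperbolic rank of a face: the maximal rank of its elements (ranks are at most `deg h`). -/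
def faceRank (h : MvPolynomial (Fin n) ℝ) (e : Fin n → ℝ) (F : PointedCone ℝ (Fin n → ℝ)) : ℕ :=
  sSup (hypRank h e '' (F : Set (Fin n → ℝ)))

/-- An extreme ray of `C`: a face that is a half-line `{r v : r ≥ 0}` with `v ≠ 0`. -/
def IsExtremeRay (C : Set (Fin n → ℝ)) (F : PointedCone ℝ (Fin n → ℝ)) : Prop :=
  IsFace C F ∧ ∃ v : Fin n → ℝ, v ≠ 0 ∧ (F : Set (Fin n → ℝ)) = {x | ∃ r : ℝ, 0 ≤ r ∧ x = r • v}

/-- The partially ordered set `P` is a geometric lattice (not necessarily finite) that is modular: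
binary joins and meets exist in the order of `P`, the lattice has finite length, every element is
the join of a set of atoms, and it is (upper) semimodular; and moreover the modular law holds. -/
def IsModularGeometricLattice (P : Type*) [inst : PartialOrder P] : Prop :=
  (∃ L : Lattice P, L.toPartialOrder = inst ∧
      @IsUpperModularLattice P L ∧ @IsModularLattice P L) ∧
    (∃ _ : OrderBot P, IsAtomistic P) ∧
    FiniteDimensionalOrder P

end Hyperbolic

end

noncomputable section

namespace Hyperbolic

open Polynomial

variable {n : ℕ}

/-! ### Restriction of a homogeneous polynomial to a line. -/

section Line

variable {A : Type*} [CommRing A]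

/-! Each face is generated by the projection in its relative interior, so faces can be handled as
projections; the aim is to make these behave like orthogonal projections in a matrix algebra.

The analytic input is a half-plane property (`aeval_ne_zero_of_mem_hyperbolicityCone`), proved by
following complex roots along a homotopy. It shows that the cone is convex and that |h| increases
along cone directions (`abs_eval_le_abs_eval_add`). Since the rank of x is the degree of t ↦ h(t x +
e), comparing growth shows that the rank is monotone and, by interpolation, subadditive
(`hypRank_add_le`).

For projections, monotonicity traps h between monomial bounds: if a multiple of p dominates q, then
h splits off a power of the coordinate along e - p. Hence p - q is a projection whose rank is the
difference of the ranks (`IsProjection.sub`). So the chosen projection of a face dominates every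
projection in it, F ↦ `pr F` embeds the faces in the cone order, and e - `pr F` defines an antitone
involution turning rank r into d - r. Subadditivity makes the rank submodular; complementing gives
the reverse inequality, so the rank is modular and strictly monotone, which forces the modular law
and finite length. Atoms suffice because a nonzero projection cannot lie below both of two
projections whose sum is at most e. -/

theorem natDegree_prod_linear_le (v w : Fin n → A) (m : Fin n → ℕ) (s : Finset (Fin n)) :
    (∏ i ∈ s, (X * C (v i) + C (w i)) ^ m i).natDegree ≤ ∑ i ∈ s, m i := by
  refine (natDegree_prod_le _ _).trans (Finset.sum_le_sum fun i _ => ?_)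
  have h1 : (X * C (v i) + C (w i)).natDegree ≤ 1 := by compute_degree
  simpa using natDegree_pow_le_of_le (m i) h1

theorem coeff_prod_linear (v w : Fin n → A) (m : Fin n → ℕ) (s : Finset (Fin n)) :
    (∏ i ∈ s, (X * C (v i) + C (w i)) ^ m i).coeff (∑ i ∈ s, m i) = ∏ i ∈ s, v i ^ m i := by
  induction s using Finset.induction_on with
  | empty => simp
  | insert a s ha ih =>
    have h1 : (X * C (v a) + C (w a)).natDegree ≤ 1 := by compute_degree
    have h2 : ((X * C (v a) + C (w a)) ^ m a).natDegree ≤ m a := by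
      simpa using natDegree_pow_le_of_le (m a) h1
    have h3 : ((X * C (v a) + C (w a)) ^ m a).coeff (m a) = v a ^ m a := by
      have := coeff_pow_of_natDegree_le (m := m a) h1
      simpa using this
    rw [Finset.prod_insert ha, Finset.sum_insert ha, Finset.prod_insert ha,
      coeff_mul_add_eq_of_natDegree_le h2 (natDegree_prod_linear_le v w m s), h3, ih]

variable [Algebra ℝ A]

/-- The restriction `t ↦ h (t v + w)` of `h` to a line, as a univariate polynomial. -/
def restrictLine (h : MvPolynomial (Fin n) ℝ) (v w : Fin n → A) : A[X] :=
  MvPolynomial.aeval (fun i => X * C (v i) + C (w i)) h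

theorem eval_restrictLine (h : MvPolynomial (Fin n) ℝ) (v w : Fin n → A) (t : A) :
    (restrictLine h v w).eval t = MvPolynomial.aeval (t • v + w) h := by
  have key : ((aeval t).restrictScalars ℝ : A[X] →ₐ[ℝ] A).comp
      (MvPolynomial.aeval (fun i => X * C (v i) + C (w i))) = MvPolynomial.aeval (t • v + w) := by
    apply MvPolynomial.algHom_ext
    intro i
    simp
    ring
  have := DFunLike.congr_fun key h
  simpa [restrictLine, coe_aeval_eq_eval] using this

theorem restrictLine_eq_sum (h : MvPolynomial (Fin n) ℝ) (v w : Fin n → A) :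
    restrictLine h v w =
      ∑ m ∈ h.support, C (algebraMap ℝ A (h.coeff m)) *
        ∏ i, (X * C (v i) + C (w i)) ^ m i := by
  rw [restrictLine, MvPolynomial.aeval_def, MvPolynomial.eval₂_eq']
  rfl

variable {h : MvPolynomial (Fin n) ℝ} {d : ℕ}

theorem sum_eq_of_mem_support (hd : h.IsHomogeneous d) {m : Fin n →₀ ℕ} (hm : m ∈ h.support) :
    ∑ i, m i = d := by
  rw [← Finsupp.degree_eq_sum]
  exact (hd.degree_eq_sum_deg_support hm).symm

theorem natDegree_restrictLine_le (hd : h.IsHomogeneous d) (v w : Fin n → A) :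
    (restrictLine h v w).natDegree ≤ d := by
  rw [restrictLine_eq_sum]
  refine natDegree_sum_le_of_forall_le _ _ fun m hm => ?_
  refine (natDegree_C_mul_le _ _).trans ?_
  rw [← sum_eq_of_mem_support hd hm]
  exact natDegree_prod_linear_le v w m Finset.univ

theorem coeff_restrictLine (hd : h.IsHomogeneous d) (v w : Fin n → A) :
    (restrictLine h v w).coeff d = MvPolynomial.aeval v h := by
  rw [restrictLine_eq_sum, finsetSum_coeff, MvPolynomial.aeval_def, MvPolynomial.eval₂_eq']
  refine Finset.sum_congr rfl fun m hm => ?_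
  rw [coeff_C_mul]
  conv_lhs => rw [← sum_eq_of_mem_support hd hm]
  rw [coeff_prod_linear v w m Finset.univ]

theorem aeval_smul (hd : h.IsHomogeneous d) (c : A) (v : Fin n → A) :
    MvPolynomial.aeval (c • v) h = c ^ d * MvPolynomial.aeval v h := by
  rw [MvPolynomial.aeval_def, MvPolynomial.eval₂_eq', MvPolynomial.aeval_def,
    MvPolynomial.eval₂_eq', Finset.mul_sum]
  refine Finset.sum_congr rfl fun m hm => ?_
  rw [← sum_eq_of_mem_support hd hm]
  simp only [Pi.smul_apply, smul_eq_mul, mul_pow, Finset.prod_mul_distrib,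
    Finset.prod_pow_eq_pow_sum]
  ring

end Line

/-! ### Real and complex evaluation, and factorization by eigenvalues. -/

/-- A real vector, seen as a complex one. -/
def toComplex (x : Fin n → ℝ) : Fin n → ℂ := fun i => (x i : ℂ)

theorem toComplex_add (x y : Fin n → ℝ) : toComplex (x + y) = toComplex x + toComplex y := by
  ext i; simp [toComplex]

theorem toComplex_smul (r : ℝ) (x : Fin n → ℝ) : toComplex (r • x) = (r : ℂ) • toComplex x := by
  ext i; simp [toComplex]

theorem aeval_real (h : MvPolynomial (Fin n) ℝ) (x : Fin n → ℝ) :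
    MvPolynomial.aeval x h = MvPolynomial.eval x h := by
  rw [MvPolynomial.aeval_eq_eval]

theorem aeval_toComplex (h : MvPolynomial (Fin n) ℝ) (x : Fin n → ℝ) :
    MvPolynomial.aeval (toComplex x) h = ((MvPolynomial.eval x h : ℝ) : ℂ) := by
  rw [← aeval_real]
  exact MvPolynomial.aeval_algebraMap_apply (A := ℝ) ℂ x h

theorem continuous_aeval (h : MvPolynomial (Fin n) ℝ) :
    Continuous fun v : Fin n → ℂ => MvPolynomial.aeval v h := by
  simp only [MvPolynomial.aeval_def, MvPolynomial.eval₂_eq']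
  fun_prop

theorem continuous_eval (h : MvPolynomial (Fin n) ℝ) :
    Continuous fun v : Fin n → ℝ => MvPolynomial.eval v h := by
  exact MvPolynomial.continuous_eval h

variable {h : MvPolynomial (Fin n) ℝ} {d : ℕ} {e : Fin n → ℝ}

theorem eval_smul (hd : h.IsHomogeneous d) (c : ℝ) (v : Fin n → ℝ) :
    MvPolynomial.eval (c • v) h = c ^ d * MvPolynomial.eval v h := by
  simpa only [aeval_real] using aeval_smul (A := ℝ) hd c v

theorem linePoly_eq_restrictLine (h : MvPolynomial (Fin n) ℝ) (e x : Fin n → ℝ) :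
    linePoly h e x = restrictLine h e (-x) := by
  simp [linePoly, restrictLine, sub_eq_add_neg]

theorem eval_linePoly (h : MvPolynomial (Fin n) ℝ) (e x : Fin n → ℝ) (t : ℝ) :
    (linePoly h e x).eval t = MvPolynomial.eval (t • e - x) h := by
  rw [linePoly_eq_restrictLine, eval_restrictLine, aeval_real, sub_eq_add_neg]

theorem coeff_linePoly (hd : h.IsHomogeneous d) (x : Fin n → ℝ) :
    (linePoly h e x).coeff d = MvPolynomial.eval e h := by
  rw [linePoly_eq_restrictLine, coeff_restrictLine hd, aeval_real]

theorem natDegree_linePoly (hyp : IsHyperbolic h e) (hd : h.IsHomogeneous d) (x : Fin n → ℝ) :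
    (linePoly h e x).natDegree = d := by
  refine natDegree_eq_of_le_of_coeff_ne_zero ?_ ?_
  · rw [linePoly_eq_restrictLine]; exact natDegree_restrictLine_le hd _ _
  · rw [coeff_linePoly hd]; exact hyp.eval_ne_zero

theorem linePoly_ne_zero (hyp : IsHyperbolic h e) (x : Fin n → ℝ) : linePoly h e x ≠ 0 := by
  obtain ⟨d, hd⟩ := hyp.homogeneous
  intro h0
  have := coeff_linePoly (e := e) hd x
  rw [h0] at this
  exact hyp.eval_ne_zero (by simpa using this.symm)

theorem leadingCoeff_linePoly (hyp : IsHyperbolic h e) (x : Fin n → ℝ) :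
    (linePoly h e x).leadingCoeff = MvPolynomial.eval e h := by
  obtain ⟨d, hd⟩ := hyp.homogeneous
  rw [leadingCoeff, natDegree_linePoly hyp hd, coeff_linePoly hd]

theorem card_eigenvalues (hyp : IsHyperbolic h e) (hd : h.IsHomogeneous d) (x : Fin n → ℝ) :
    (eigenvalues h e x).card = d := by
  rw [eigenvalues, ← (hyp.splits x).natDegree_eq_card_roots, natDegree_linePoly hyp hd]

theorem mem_eigenvalues (hyp : IsHyperbolic h e) {x : Fin n → ℝ} {t : ℝ} :
    t ∈ eigenvalues h e x ↔ MvPolynomial.eval (t • e - x) h = 0 := by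
  rw [eigenvalues, mem_roots (linePoly_ne_zero hyp x), IsRoot, eval_linePoly]

theorem eval_sub_eq_prod (hyp : IsHyperbolic h e) (x : Fin n → ℝ) (t : ℝ) :
    MvPolynomial.eval (t • e - x) h =
      MvPolynomial.eval e h * ((eigenvalues h e x).map fun l => t - l).prod := by
  rw [← eval_linePoly, (hyp.splits x).eval_eq_prod_roots, leadingCoeff_linePoly hyp, eigenvalues]

theorem eval_add_eq_prod (hyp : IsHyperbolic h e) (x : Fin n → ℝ) (s : ℝ) :
    MvPolynomial.eval (s • e + x) h =
      MvPolynomial.eval e h * ((eigenvalues h e x).map fun l => s + l).prod := by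
  obtain ⟨d, hd⟩ := hyp.homogeneous
  have h1 : s • e + x = (-1 : ℝ) • ((-s) • e - x) := by module
  have h2 : (fun l : ℝ => s + l) = fun l => (-1) * (-s - l) := by ext l; ring
  rw [h1, eval_smul hd, eval_sub_eq_prod hyp, h2, Multiset.prod_map_mul]
  simp only [Multiset.map_const', Multiset.prod_replicate, card_eigenvalues hyp hd]
  ring

theorem aeval_add_eq_prod (hyp : IsHyperbolic h e) (x : Fin n → ℝ) (s : ℂ) :
    MvPolynomial.aeval (s • toComplex e + toComplex x) h =
      (MvPolynomial.eval e h : ℂ) * ((eigenvalues h e x).map fun l : ℝ => s + (l : ℂ)).prod := by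
  have hP : (restrictLine h (toComplex e) (toComplex x)) =
      (C (MvPolynomial.eval e h) *
        ((eigenvalues h e x).map fun l => X + C l).prod).map (algebraMap ℝ ℂ) := by
    have hreal : restrictLine h e x = C (MvPolynomial.eval e h) *
        ((eigenvalues h e x).map fun l => X + C l).prod := by
      refine Polynomial.funext fun t => ?_
      rw [eval_restrictLine, aeval_real, eval_add_eq_prod hyp, eval_mul, eval_C,
        eval_multiset_prod, Multiset.map_map]
      simp
    rw [← hreal]
    -- The two complex polynomials agree at every real point, which is enough to identify them.
    refine Polynomial.eq_of_infinite_eval_eq _ _ ?_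
    refine (Set.infinite_range_of_injective Complex.ofReal_injective).mono ?_
    rintro _ ⟨t, rfl⟩
    simp only [Set.mem_ofPred_eq]
    rw [eval_restrictLine, ← toComplex_smul, ← toComplex_add, aeval_toComplex, ← aeval_real h,
      ← eval_restrictLine]
    exact (Polynomial.eval_map_apply (algebraMap ℝ ℂ) t).symm
  rw [← eval_restrictLine, hP, Polynomial.map_mul, eval_mul, Polynomial.map_multiset_prod,
    Polynomial.eval_multiset_prod, Multiset.map_map, Multiset.map_map]
  simp

/-- The zeros of s ↦ h(s e + x) are the negated eigenvalues. This root-free criterion is the working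
description of the cone. -/
theorem mem_hyperbolicityCone_iff (hyp : IsHyperbolic h e) {x : Fin n → ℝ} :
    x ∈ hyperbolicityCone h e ↔ ∀ s : ℝ, 0 < s → MvPolynomial.eval (s • e + x) h ≠ 0 := by
  obtain ⟨d, hd⟩ := hyp.homogeneous
  constructor
  · intro hx s hs
    rw [eval_add_eq_prod hyp]
    refine mul_ne_zero hyp.eval_ne_zero (Multiset.prod_ne_zero fun h0 => ?_)
    obtain ⟨l, hl, h0⟩ := Multiset.mem_map.1 h0
    linarith [hx l hl]
  · intro H t ht
    by_contra! hneg
    refine H (-t) (by linarith) ?_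
    have h1 : (-t) • e + x = (-1 : ℝ) • (t • e - x) := by module
    rw [h1, eval_smul hd, (mem_eigenvalues hyp).1 ht, mul_zero]

/-! ### Continuity of roots and the half-plane property. -/

theorem exists_norm_le_of_aeval_eq_zero (hd : h.IsHomogeneous d) {a : Fin n → ℂ}
    (ha : MvPolynomial.aeval a h ≠ 0) (R : ℝ) :
    ∃ B : ℝ, ∀ (t : ℂ) (u : Fin n → ℂ), ‖u‖ ≤ R → MvPolynomial.aeval (t • a + u) h = 0 →
      ‖t‖ ≤ B := by
  have hopen : IsOpen {v : Fin n → ℂ | MvPolynomial.aeval v h ≠ 0} :=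
    isOpen_ne_fun (continuous_aeval h) continuous_const
  obtain ⟨δ, hδ, hball⟩ := Metric.isOpen_iff.1 hopen a ha
  refine ⟨R / δ, fun t u hu ht => ?_⟩
  have hR : 0 ≤ R := (norm_nonneg u).trans hu
  by_contra! hlt
  have htn : 0 < ‖t‖ := lt_of_le_of_lt (by positivity) hlt
  have ht0 : t ≠ 0 := norm_pos_iff.1 htn
  -- By homogeneity a zero t gives the zero a + u/t of h, which lies in the zero-free ball about a
  -- once |t| exceeds R/δ.
  have h1 : t • a + u = t • (a + t⁻¹ • u) := by
    rw [smul_add, smul_smul, mul_inv_cancel₀ ht0, one_smul]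
  rw [h1, aeval_smul hd] at ht
  refine hball (?_ : a + t⁻¹ • u ∈ Metric.ball a δ)
    ((mul_eq_zero.1 ht).resolve_left (pow_ne_zero _ ht0))
  rw [Metric.mem_ball, dist_eq_norm, add_sub_cancel_left, norm_smul, norm_inv,
    inv_mul_lt_iff₀ htn]
  rw [div_lt_iff₀ hδ] at hlt
  linarith

/-- A quantitative Hurwitz theorem: if all d roots had imaginary part at most 0, each would be at
distance at least Im z from z, and the product of these distances would bound the value at z from
below. -/
theorem exists_root_im_pos (hd : h.IsHomogeneous d) {a u : Fin n → ℂ} {z : ℂ} (hz : 0 < z.im)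
    (hlt : ‖MvPolynomial.aeval (z • a + u) h‖ < ‖MvPolynomial.aeval a h‖ * z.im ^ d) :
    ∃ t : ℂ, 0 < t.im ∧ MvPolynomial.aeval (t • a + u) h = 0 := by
  by_contra! hno
  have ha : MvPolynomial.aeval a h ≠ 0 := by
    intro h0
    rw [h0] at hlt
    simp only [norm_zero, zero_mul] at hlt
    exact absurd hlt (not_lt.2 (norm_nonneg _))
  have hdeg : (restrictLine h a u).natDegree = d :=
    natDegree_eq_of_le_of_coeff_ne_zero (natDegree_restrictLine_le hd _ _)
      (by rwa [coeff_restrictLine hd])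
  have hs := IsAlgClosed.splits (restrictLine h a u)
  have hP0 : restrictLine h a u ≠ 0 := by
    intro h0
    have := coeff_restrictLine hd a u
    rw [h0] at this
    exact ha (by simpa using this.symm)
  have hlc : (restrictLine h a u).leadingCoeff = MvPolynomial.aeval a h := by
    rw [leadingCoeff, hdeg, coeff_restrictLine hd]
  have heq := hs.eval_eq_prod_roots z
  rw [eval_restrictLine, hlc] at heq
  rw [heq, norm_mul] at hlt
  refine absurd (lt_of_mul_lt_mul_left hlt (norm_nonneg _)) (not_lt.2 ?_)
  have hcard : (restrictLine h a u).roots.card = d := by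
    rw [← hs.natDegree_eq_card_roots, hdeg]
  have hroot : ∀ r ∈ (restrictLine h a u).roots, z.im ≤ ‖z - r‖ := by
    intro r hr
    have h1 : r.im ≤ 0 := by
      by_contra! hpos
      refine hno r hpos ?_
      rw [← eval_restrictLine]
      exact (mem_roots hP0).1 hr
    calc z.im ≤ (z - r).im := by rw [Complex.sub_im]; linarith
      _ ≤ ‖z - r‖ := (le_abs_self _).trans (Complex.abs_im_le_norm _)
  rw [← hcard]
  generalize (restrictLine h a u).roots = m at hroot
  induction m using Multiset.induction_on with
  | empty => simp
  | cons r m ih =>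
    rw [Multiset.card_cons, pow_succ', Multiset.map_cons, Multiset.prod_cons, norm_mul]
    refine mul_le_mul (hroot r (Multiset.mem_cons_self _ _))
      (ih fun r' hr' => hroot r' (Multiset.mem_cons_of_mem hr')) (by positivity) (norm_nonneg _)

/-- If `h (t a + σ v + w)` has no real zero `t` for `σ ∈ [0, 1]`, and no zero in the closed upper
half-plane for `σ = 0`, then it has no zero in the closed upper half-plane for `σ = 1`. -/
theorem aeval_ne_zero_of_homotopy (hd : h.IsHomogeneous d) {a v w : Fin n → ℂ}
    (ha : MvPolynomial.aeval a h ≠ 0)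
    (h0 : ∀ t : ℂ, 0 ≤ t.im → MvPolynomial.aeval (t • a + w) h ≠ 0)
    (hreal : ∀ σ : ℝ, 0 ≤ σ → σ ≤ 1 → ∀ r : ℝ,
      MvPolynomial.aeval ((r : ℂ) • a + ((σ : ℂ) • v + w)) h ≠ 0)
    {t : ℂ} (ht : 0 ≤ t.im) : MvPolynomial.aeval (t • a + (v + w)) h ≠ 0 := by
  let f : unitInterval × ℂ → ℂ := fun q =>
    MvPolynomial.aeval (q.2 • a + (((q.1 : ℝ) : ℂ) • v + w)) h
  have hf : Continuous f := (continuous_aeval h).comp (by fun_prop)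
  let T : Set unitInterval := {σ | ∃ t : ℂ, 0 ≤ t.im ∧ f (σ, t) = 0}
  obtain ⟨B, hB⟩ := exists_norm_le_of_aeval_eq_zero hd ha (‖v‖ + ‖w‖)
  -- The zeros stay in a fixed ball, so T is the projection of a compact set.
  have hclosed : IsClosed T := by
    have himg : T = Prod.fst '' ((Set.univ ×ˢ Metric.closedBall (0 : ℂ) B) ∩
        {q : unitInterval × ℂ | 0 ≤ q.2.im ∧ f q = 0}) := by
      ext σ
      constructor
      · rintro ⟨t, ht, hft⟩
        refine ⟨(σ, t), ⟨⟨Set.mem_univ _, ?_⟩, ht, hft⟩, rfl⟩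
        rw [mem_closedBall_zero_iff]
        refine hB t _ ((norm_add_le _ _).trans ?_) hft
        gcongr
        rw [norm_smul, Complex.norm_real, Real.norm_eq_abs, abs_of_nonneg σ.2.1]
        exact mul_le_of_le_one_left (norm_nonneg _) σ.2.2
      · rintro ⟨⟨σ', t⟩, ⟨-, ht, hft⟩, rfl⟩
        exact ⟨t, ht, hft⟩
    rw [himg]
    refine IsCompact.isClosed (IsCompact.image ?_ continuous_fst)
    refine (isCompact_univ.prod (isCompact_closedBall _ _)).inter_right ?_
    exact (isClosed_le continuous_const (Complex.continuous_im.comp continuous_snd)).inter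
      (isClosed_eq hf continuous_const)
  -- A zero in the closed half-plane is not real, so it is in the open one, where
  -- `exists_root_im_pos` keeps a zero for nearby σ. Connectedness of the interval then decides.
  have hopen : IsOpen T := by
    rw [isOpen_iff_mem_nhds]
    rintro σ ⟨z, hz, hfz⟩
    have hzpos : 0 < z.im := by
      refine lt_of_le_of_ne hz fun hz0 => hreal σ σ.2.1 σ.2.2 z.re ?_
      have : ((z.re : ℝ) : ℂ) = z := Complex.ext (by simp) (by simp [← hz0])
      rw [this]
      exact hfz
    have hcont : Continuous fun σ' : unitInterval => ‖f (σ', z)‖ :=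
      (hf.comp (by fun_prop : Continuous fun σ' : unitInterval => (σ', z))).norm
    have hpos : ‖f (σ, z)‖ < ‖MvPolynomial.aeval a h‖ * z.im ^ d := by
      rw [hfz, norm_zero]
      have := norm_pos_iff.2 ha
      positivity
    filter_upwards [(isOpen_lt hcont continuous_const).mem_nhds hpos] with σ' hσ'
    obtain ⟨t, ht, h1⟩ := exists_root_im_pos hd hzpos hσ'
    exact ⟨t, ht.le, h1⟩
  have hT : T = ∅ := by
    rcases isClopen_iff.1 ⟨hclosed, hopen⟩ with h1 | h1
    · exact h1
    · have : (0 : unitInterval) ∈ T := h1 ▸ Set.mem_univ _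
      obtain ⟨t, ht, hft⟩ := this
      exact absurd (by simpa [f] using hft) (h0 t ht)
  intro hzero
  have : (1 : unitInterval) ∈ T := ⟨t, ht, by simpa [f] using hzero⟩
  rw [hT] at this
  exact this

theorem aeval_smul_add_smul_ne_zero (hyp : IsHyperbolic h e) {a : Fin n → ℝ}
    (ha : a ∈ hyperbolicityCone h e) {t s : ℂ} (ht : 0 ≤ t.im) (hs : 0 < s.im) :
    MvPolynomial.aeval (t • toComplex a + s • toComplex e) h ≠ 0 := by
  obtain ⟨d, hd⟩ := hyp.homogeneous
  have he : MvPolynomial.aeval (toComplex e) h ≠ 0 := by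
    rw [aeval_toComplex]; exact_mod_cast hyp.eval_ne_zero
  have hs0 : s ≠ 0 := fun h0 => by simp [h0] at hs
  rcases eq_or_ne t 0 with rfl | ht0
  · rw [zero_smul, zero_add, aeval_smul hd]
    exact mul_ne_zero (pow_ne_zero _ hs0) he
  · have h1 : t • toComplex a + s • toComplex e = t • ((s / t) • toComplex e + toComplex a) := by
      rw [smul_add, smul_smul, mul_div_cancel₀ _ ht0, add_comm]
    rw [h1, aeval_smul hd, aeval_add_eq_prod hyp]
    refine mul_ne_zero (pow_ne_zero _ ht0) (mul_ne_zero (by exact_mod_cast hyp.eval_ne_zero)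
      (Multiset.prod_ne_zero fun h0 => ?_))
    obtain ⟨l, hl, h0⟩ := Multiset.mem_map.1 h0
    have h2 : s + l * t = 0 := by
      field_simp at h0
      linear_combination h0
    have h3 := congrArg Complex.im h2
    simp only [Complex.add_im, Complex.mul_im, Complex.ofReal_re, Complex.ofReal_im, zero_mul,
      add_zero, Complex.zero_im] at h3
    have := mul_nonneg (ha l hl) ht
    linarith

theorem aeval_toComplex_add_ne_zero (hyp : IsHyperbolic h e) (x : Fin n → ℝ) {s : ℂ}
    (hs : 0 < s.im) : MvPolynomial.aeval (toComplex x + s • toComplex e) h ≠ 0 := by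
  rw [add_comm, aeval_add_eq_prod hyp]
  refine mul_ne_zero (by exact_mod_cast hyp.eval_ne_zero) (Multiset.prod_ne_zero fun h0 => ?_)
  obtain ⟨l, hl, h0⟩ := Multiset.mem_map.1 h0
  have h3 := congrArg Complex.im h0
  simp only [Complex.add_im, Complex.ofReal_im, add_zero, Complex.zero_im] at h3
  linarith

theorem add_smul_mem_hyperbolicityCone (hyp : IsHyperbolic h e) {a : Fin n → ℝ}
    (ha : a ∈ hyperbolicityCone h e) {r : ℝ} (hr : 0 ≤ r) : a + r • e ∈ hyperbolicityCone h e := by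
  rw [mem_hyperbolicityCone_iff hyp] at ha ⊢
  intro s hs
  have : s • e + (a + r • e) = (s + r) • e + a := by module
  rw [this]
  exact ha _ (by linarith)

/-- A half-plane property of hyperbolic polynomials can be extended by a direction of the
hyperbolicity cone. -/
theorem aeval_ne_zero_extend (hyp : IsHyperbolic h e) {K : Set (Fin n → ℂ)}
    (hKsmul : ∀ v ∈ K, ∀ σ : ℝ, 0 ≤ σ → σ ≤ 1 → (σ : ℂ) • v ∈ K)
    (hKadd : ∀ v ∈ K, ∀ x : Fin n → ℝ, v + toComplex x ∈ K)
    (hK : ∀ v ∈ K, ∀ s : ℂ, 0 < s.im → MvPolynomial.aeval (v + s • toComplex e) h ≠ 0)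
    {a : Fin n → ℝ} (ha : a ∈ hyperbolicityCone h e) {v : Fin n → ℂ} (hv : v ∈ K) {t s : ℂ}
    (ht : 0 ≤ t.im) (hs : 0 < s.im) :
    MvPolynomial.aeval (v + t • toComplex a + s • toComplex e) h ≠ 0 := by
  obtain ⟨d, hd⟩ := hyp.homogeneous
  -- h may vanish at a, so a is replaced by a + ε e; the compensating coefficient s - ε t must keep
  -- positive imaginary part.
  obtain ⟨ε, hε, hεs⟩ : ∃ ε : ℝ, 0 < ε ∧ ε * t.im < s.im := by
    refine ⟨s.im / (t.im + 1), by positivity, ?_⟩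
    rw [div_mul_eq_mul_div, div_lt_iff₀ (by linarith)]
    nlinarith
  have hmem := add_smul_mem_hyperbolicityCone hyp ha hε.le
  have hne : MvPolynomial.aeval (toComplex (a + ε • e)) h ≠ 0 := by
    rw [aeval_toComplex]
    have := (mem_hyperbolicityCone_iff hyp).1 ha ε hε
    rw [add_comm] at this
    exact_mod_cast this
  have him : 0 < (s - ε * t).im := by simpa using hεs
  have key := aeval_ne_zero_of_homotopy (v := v) (w := (s - ε * t) • toComplex e) hd hne
    (fun t' ht' => aeval_smul_add_smul_ne_zero hyp hmem ht' him)
    (fun σ h0 h1 r => by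
      have := hK _ (hKadd _ (hKsmul v hv σ h0 h1) (r • (a + ε • e))) _ him
      rw [toComplex_smul] at this
      convert this using 2
      congr 1
      abel) ht
  convert key using 2
  congr 1
  rw [toComplex_add, toComplex_smul]
  module

/-- The half-plane property of a hyperbolic polynomial, for two directions of the hyperbolicity
cone. -/
theorem aeval_ne_zero_of_mem_hyperbolicityCone (hyp : IsHyperbolic h e) {a b : Fin n → ℝ}
    (ha : a ∈ hyperbolicityCone h e) (hb : b ∈ hyperbolicityCone h e) {t u s : ℂ}
    (ht : 0 ≤ t.im) (hu : 0 ≤ u.im) (hs : 0 < s.im) :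
    MvPolynomial.aeval (t • toComplex a + u • toComplex b + s • toComplex e) h ≠ 0 := by
  have step1 : ∀ (x : Fin n → ℝ) (t s : ℂ), 0 ≤ t.im → 0 < s.im →
      MvPolynomial.aeval (toComplex x + t • toComplex a + s • toComplex e) h ≠ 0 := by
    intro x t s ht hs
    refine aeval_ne_zero_extend hyp (K := Set.range toComplex) ?_ ?_ ?_ ha ⟨x, rfl⟩ ht hs
    · rintro _ ⟨x, rfl⟩ σ - -
      exact ⟨σ • x, toComplex_smul _ _⟩
    · rintro _ ⟨x, rfl⟩ y
      exact ⟨x + y, toComplex_add _ _⟩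
    · rintro _ ⟨x, rfl⟩ s hs
      exact aeval_toComplex_add_ne_zero hyp x hs
  refine aeval_ne_zero_extend hyp
    (K := {v | ∃ (x : Fin n → ℝ) (t : ℂ), 0 ≤ t.im ∧ v = toComplex x + t • toComplex a})
    ?_ ?_ ?_ hb ⟨0, t, ht, ?_⟩ hu hs
  · rintro _ ⟨x, t, ht, rfl⟩ σ h0 -
    refine ⟨σ • x, σ * t, ?_, ?_⟩
    · simpa using mul_nonneg h0 ht
    · rw [toComplex_smul, smul_add, smul_smul]
  · rintro _ ⟨x, t, ht, rfl⟩ y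
    refine ⟨x + y, t, ht, ?_⟩
    rw [toComplex_add]
    abel
  · rintro _ ⟨x, t, ht, rfl⟩ s hs
    exact step1 x t s ht hs
  · ext i; simp [toComplex]

/-- Multiplication by i rotates the right half-plane to the upper one, and homogeneity absorbs the
factor. -/
theorem eval_ne_zero_of_re_nonneg (hyp : IsHyperbolic h e) {a b : Fin n → ℝ}
    (ha : a ∈ hyperbolicityCone h e) (hb : b ∈ hyperbolicityCone h e) {t u s : ℂ}
    (ht : 0 ≤ t.re) (hu : 0 ≤ u.re) (hs : 0 < s.re) :
    MvPolynomial.aeval (t • toComplex a + u • toComplex b + s • toComplex e) h ≠ 0 := by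
  obtain ⟨d, hd⟩ := hyp.homogeneous
  have := aeval_ne_zero_of_mem_hyperbolicityCone hyp ha hb (t := Complex.I * t)
    (u := Complex.I * u) (s := Complex.I * s) (by simpa) (by simpa) (by simpa)
  rw [← smul_smul, ← smul_smul, ← smul_smul, ← smul_add, ← smul_add, aeval_smul hd] at this
  exact right_ne_zero_of_mul this

/-! ### Convexity of the cone and monotonicity of |h|. -/

theorem zero_mem_hyperbolicityCone (hyp : IsHyperbolic h e) : 0 ∈ hyperbolicityCone h e := by
  obtain ⟨d, hd⟩ := hyp.homogeneous
  rw [mem_hyperbolicityCone_iff hyp]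
  intro s hs
  rw [add_zero, eval_smul hd]
  exact mul_ne_zero (pow_ne_zero _ hs.ne') hyp.eval_ne_zero

theorem smul_mem_hyperbolicityCone (hyp : IsHyperbolic h e) {x : Fin n → ℝ}
    (hx : x ∈ hyperbolicityCone h e) {r : ℝ} (hr : 0 ≤ r) : r • x ∈ hyperbolicityCone h e := by
  obtain ⟨d, hd⟩ := hyp.homogeneous
  rcases hr.eq_or_lt with rfl | hr
  · rw [zero_smul]; exact zero_mem_hyperbolicityCone hyp
  rw [mem_hyperbolicityCone_iff hyp] at hx ⊢
  intro s hs
  have : s • e + r • x = r • ((s / r) • e + x) := by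
    rw [smul_add, smul_smul, mul_div_cancel₀ _ hr.ne']
  rw [this, eval_smul hd]
  exact mul_ne_zero (pow_ne_zero _ hr.ne') (hx _ (by positivity))

/-- The hyperbolicity cone is closed under addition (Gårding). -/
theorem add_mem_hyperbolicityCone (hyp : IsHyperbolic h e) {x y : Fin n → ℝ}
    (hx : x ∈ hyperbolicityCone h e) (hy : y ∈ hyperbolicityCone h e) :
    x + y ∈ hyperbolicityCone h e := by
  rw [mem_hyperbolicityCone_iff hyp]
  intro s hs h0
  refine eval_ne_zero_of_re_nonneg hyp hx hy (t := 1) (u := 1) (s := (s : ℂ)) (by simp) (by simp)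
    (by simpa) ?_
  rw [one_smul, one_smul, ← toComplex_smul, ← toComplex_add, ← toComplex_add, aeval_toComplex,
    add_comm, h0, Complex.ofReal_zero]

/-- A hyperbolic polynomial is monotone on its hyperbolicity cone, up to sign. -/
theorem abs_eval_le_abs_eval_add (hyp : IsHyperbolic h e) {x y : Fin n → ℝ}
    (hx : x ∈ hyperbolicityCone h e) (hy : y ∈ hyperbolicityCone h e) :
    |MvPolynomial.eval x h| ≤ |MvPolynomial.eval (x + y) h| := by
  -- After the shift by ε e, all roots of z ↦ h(x + ε e + z y) have negative real part, so each is
  -- nearer to 0 than to 1. Letting ε tend to 0 removes the shift.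
  have key : ∀ ε : ℝ, 0 < ε →
      |MvPolynomial.eval (x + ε • e) h| ≤ |MvPolynomial.eval (x + ε • e + y) h| := by
    intro ε hε
    set P := restrictLine h (toComplex y) (toComplex (x + ε • e)) with hP
    have hne : ∀ z : ℂ, 0 ≤ z.re → P.eval z ≠ 0 := by
      intro z hz
      rw [hP, eval_restrictLine]
      have := eval_ne_zero_of_re_nonneg hyp hx hy (t := 1) (u := z) (s := (ε : ℂ)) (by simp) hz
        (by simpa)
      rw [toComplex_add, toComplex_smul]
      convert this using 2
      congr 1
      module
    have hP0 : P ≠ 0 := fun h0 => hne 0 le_rfl (by rw [h0, eval_zero])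
    have hroot : ∀ r ∈ P.roots, r.re < 0 := by
      intro r hr
      by_contra! hr0
      exact hne r hr0 ((mem_roots hP0).1 hr)
    have h0 := (IsAlgClosed.splits P).eval_eq_prod_roots 0
    have h1 := (IsAlgClosed.splits P).eval_eq_prod_roots 1
    have hle : ‖P.eval 0‖ ≤ ‖P.eval 1‖ := by
      rw [h0, h1, norm_mul, norm_mul]
      refine mul_le_mul_of_nonneg_left ?_ (norm_nonneg _)
      generalize P.roots = m at hroot
      induction m using Multiset.induction_on with
      | empty => simp
      | cons r m ih =>
        rw [Multiset.map_cons, Multiset.prod_cons, Multiset.map_cons, Multiset.prod_cons, norm_mul,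
          norm_mul]
        refine mul_le_mul ?_ (ih fun r' hr' => hroot r' (Multiset.mem_cons_of_mem hr'))
          (norm_nonneg _) (norm_nonneg _)
        have hr := hroot r (Multiset.mem_cons_self _ _)
        rw [zero_sub, norm_neg, Complex.norm_def, Complex.norm_def]
        refine Real.sqrt_le_sqrt ?_
        simp only [Complex.normSq_apply, Complex.sub_re, Complex.sub_im, Complex.one_re,
          Complex.one_im]
        nlinarith
    rw [hP, eval_restrictLine, eval_restrictLine, zero_smul, zero_add, one_smul, ← toComplex_add,
      aeval_toComplex, aeval_toComplex, Complex.norm_real, Complex.norm_real] at hle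
    rw [add_comm _ y]
    exact hle
  have lim : ∀ z : Fin n → ℝ, Filter.Tendsto
      (fun ε : ℝ => |MvPolynomial.eval (x + ε • e + z) h|) (nhdsWithin 0 (Set.Ioi 0))
      (nhds |MvPolynomial.eval (x + z) h|) := by
    intro z
    have hc : Continuous fun ε : ℝ => |MvPolynomial.eval (x + ε • e + z) h| :=
      ((continuous_eval h).comp (by fun_prop)).abs
    have := (hc.tendsto 0).mono_left (nhdsWithin_le_nhds (s := Set.Ioi 0))
    simpa using this
  have l0 := lim 0
  simp only [add_zero] at l0
  exact le_of_tendsto_of_tendsto l0 (lim y) (Filter.eventually_of_mem self_mem_nhdsWithin key)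

/-! ### Growth of real polynomials on the positive half-line. -/

section Growth

theorem eq_of_eval_eq_of_pos {P Q : ℝ[X]} (hPQ : ∀ s : ℝ, 0 < s → P.eval s = Q.eval s) : P = Q :=
  Polynomial.eq_of_infinite_eval_eq _ _ ((Set.Ioi_infinite (0 : ℝ)).mono fun s hs => hPQ s hs)

theorem natDegree_le_of_abs_eval_le {P Q : ℝ[X]}
    (hPQ : ∀ s : ℝ, 0 < s → |P.eval s| ≤ |Q.eval s|) : P.natDegree ≤ Q.natDegree := by
  rcases eq_or_ne Q 0 with rfl | hQ
  · have : P = 0 := eq_of_eval_eq_of_pos fun s hs => by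
      have := hPQ s hs
      rw [eval_zero, abs_zero, abs_nonpos_iff] at this
      rw [this, eval_zero]
    simp [this]
  refine natDegree_le_natDegree ?_
  by_contra! hlt
  have h1 := abs_div_tendsto_atTop_atTop_of_degree_gt P Q hlt hQ
  obtain ⟨s, hs1, hs0⟩ :=
    ((h1.eventually_gt_atTop 1).and (Filter.eventually_gt_atTop (0 : ℝ))).exists
  rw [abs_div] at hs1
  exact absurd hs1 (not_lt.2 (div_le_one_of_le₀ (hPQ s hs0) (abs_nonneg _)))

/-- The bound near 0 forces divisibility by X^m and the bound at infinity forces degree at most m.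
The induction peels off one factor X at a time. -/
theorem eq_C_mul_X_pow_of_abs_eval_le {B : ℝ} : ∀ (m : ℕ) (P : ℝ[X]),
    (∀ s : ℝ, 0 < s → |P.eval s| ≤ B * s ^ m) → ∀ s : ℝ, P.eval s = s ^ m * P.eval 1 := by
  intro m
  induction m with
  | zero =>
    intro P hP s
    have hdeg : P.natDegree ≤ (C B).natDegree := natDegree_le_of_abs_eval_le fun s hs => by
      have := hP s hs
      rw [pow_zero, mul_one] at this
      rw [eval_C]
      exact this.trans (le_abs_self _)
    rw [natDegree_C] at hdeg
    rw [eq_C_of_natDegree_le_zero hdeg]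
    simp
  | succ m ih =>
    intro P hP s
    have h0 : P.eval 0 = 0 := by
      have hc : Filter.Tendsto (fun s : ℝ => |P.eval s|) (nhdsWithin 0 (Set.Ioi 0))
          (nhds |P.eval 0|) := (P.continuous.abs.tendsto 0).mono_left nhdsWithin_le_nhds
      have hc' : Filter.Tendsto (fun s : ℝ => B * s ^ (m + 1)) (nhdsWithin 0 (Set.Ioi 0))
          (nhds (B * 0 ^ (m + 1))) :=
        (Continuous.tendsto (by fun_prop) 0).mono_left nhdsWithin_le_nhds
      have := le_of_tendsto_of_tendsto hc hc' (Filter.eventually_of_mem self_mem_nhdsWithin hP)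
      simpa using this
    obtain ⟨Q, rfl⟩ : X ∣ P := by
      rw [X_dvd_iff, coeff_zero_eq_eval_zero, h0]
    have hQ := ih Q (fun s hs => by
      have := hP s hs
      rw [eval_mul, eval_X, abs_mul, abs_of_pos hs, pow_succ'] at this
      exact le_of_mul_le_mul_left (by linarith) hs) s
    rw [eval_mul, eval_mul, eval_X, eval_X, hQ]
    ring

end Growth

theorem eval_smul_add_smul_eq_prod (hyp : IsHyperbolic h e) (x : Fin n → ℝ) (s u : ℝ) :
    MvPolynomial.eval (s • e + u • x) h =
      MvPolynomial.eval e h * ((eigenvalues h e x).map fun l => s + u * l).prod := by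
  obtain ⟨d, hd⟩ := hyp.homogeneous
  rcases eq_or_ne u 0 with rfl | hu
  · rw [zero_smul, add_zero, eval_smul hd]
    simp [card_eigenvalues hyp hd, mul_comm]
  · have h1 : s • e + u • x = u • ((s / u) • e + x) := by
      rw [smul_add, smul_smul, mul_div_cancel₀ _ hu]
    have h2 : (fun l : ℝ => s + u * l) = fun l => u * (s / u + l) := by
      ext l; field_simp
    rw [h1, eval_smul hd, eval_add_eq_prod hyp, h2, Multiset.prod_map_mul]
    simp only [Multiset.map_const', Multiset.prod_replicate, card_eigenvalues hyp hd]
    ring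

theorem exists_smul_sub_mem_hyperbolicityCone (hyp : IsHyperbolic h e) {y : Fin n → ℝ}
    (hy : y ∈ hyperbolicityCone h e) : ∃ B : ℝ, 0 ≤ B ∧ B • e - y ∈ hyperbolicityCone h e := by
  -- Any common upper bound of the eigenvalues would do; they are nonnegative, so their sum is one.
  refine ⟨(eigenvalues h e y).sum, Multiset.sum_nonneg hy, ?_⟩
  rw [mem_hyperbolicityCone_iff hyp]
  intro s hs
  have h1 : s • e + ((eigenvalues h e y).sum • e - y) =
      (s + (eigenvalues h e y).sum) • e + (-1 : ℝ) • y := by module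
  rw [h1, eval_smul_add_smul_eq_prod hyp]
  refine mul_ne_zero hyp.eval_ne_zero (Multiset.prod_ne_zero fun h0 => ?_)
  obtain ⟨l, hl, h0⟩ := Multiset.mem_map.1 h0
  have := Multiset.single_le_sum hy l hl
  linarith

/-! ### Rank as a degree: monotonicity and subadditivity. -/

section Rank

theorem restrictLine_smul_eq_prod (hyp : IsHyperbolic h e) (x : Fin n → ℝ) (r : ℝ) :
    restrictLine h x (r • e) = C (MvPolynomial.eval e h) *
      ((eigenvalues h e x).map fun l => C r + X * C l).prod := by
  refine Polynomial.funext fun t => ?_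
  rw [eval_restrictLine, aeval_real, add_comm, eval_smul_add_smul_eq_prod hyp, eval_mul, eval_C,
    eval_multiset_prod, Multiset.map_map]
  simp only [Function.comp_def, eval_add, eval_mul, eval_C, eval_X]

theorem natDegree_prod_le_card_filter (m : Multiset ℝ) (r : ℝ) :
    (m.map fun l => C r + X * C l).prod.natDegree ≤ (m.filter fun t => t ≠ 0).card := by
  induction m using Multiset.induction_on with
  | empty => simp
  | cons l m ih =>
    rw [Multiset.map_cons, Multiset.prod_cons]
    refine natDegree_mul_le.trans ?_
    by_cases hl : l = 0
    · simpa [hl] using ih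
    · rw [Multiset.filter_cons_of_pos (p := fun t : ℝ => t ≠ 0) _ hl, Multiset.card_cons, add_comm]
      have : (C r + X * C l).natDegree ≤ 1 := by compute_degree
      omega

theorem natDegree_prod_eq_card_filter (m : Multiset ℝ) :
    (m.map fun l => C (1 : ℝ) + X * C l).prod.natDegree = (m.filter fun t => t ≠ 0).card ∧
      (m.map fun l => C (1 : ℝ) + X * C l).prod ≠ 0 := by
  induction m using Multiset.induction_on with
  | empty => simp
  | cons l m ih =>
    rw [Multiset.map_cons, Multiset.prod_cons]
    have hne : C (1 : ℝ) + X * C l ≠ 0 := fun h0 => by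
      have := congrArg (eval 0) h0
      simp at this
    refine ⟨?_, mul_ne_zero hne ih.2⟩
    rw [natDegree_mul hne ih.2, ih.1]
    by_cases hl : l = 0
    · simp [hl]
    · rw [Multiset.filter_cons_of_pos (p := fun t : ℝ => t ≠ 0) _ hl, Multiset.card_cons, add_comm]
      have : (C (1 : ℝ) + X * C l).natDegree = 1 := by
        rw [mul_comm, add_comm]
        exact natDegree_linear hl
      omega

theorem natDegree_restrictLine_smul_le (hyp : IsHyperbolic h e) (x : Fin n → ℝ) (r : ℝ) :
    (restrictLine h x (r • e)).natDegree ≤ hypRank h e x := by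
  rw [restrictLine_smul_eq_prod hyp]
  exact (natDegree_C_mul_le _ _).trans (natDegree_prod_le_card_filter _ _)

/-- In h(t x + e) = h(e) ∏ (1 + t l), exactly the nonzero eigenvalues l contribute to the degree. -/
theorem natDegree_restrictLine_eq_hypRank (hyp : IsHyperbolic h e) (x : Fin n → ℝ) :
    (restrictLine h x e).natDegree = hypRank h e x := by
  have := restrictLine_smul_eq_prod hyp x 1
  rw [one_smul] at this
  rw [this, natDegree_C_mul hyp.eval_ne_zero, (natDegree_prod_eq_card_filter _).1, hypRank]

theorem hypRank_smul_le (hyp : IsHyperbolic h e) (x : Fin n → ℝ) (r : ℝ) :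
    hypRank h e (r • x) ≤ hypRank h e x := by
  rw [← natDegree_restrictLine_eq_hypRank hyp, ← natDegree_restrictLine_eq_hypRank hyp]
  have h1 : restrictLine h (r • x) e = (restrictLine h x e).comp (C r * X) := by
    refine Polynomial.funext fun t => ?_
    rw [eval_comp, eval_restrictLine, eval_restrictLine, smul_smul, eval_mul, eval_C, eval_X,
      mul_comm]
  rw [h1]
  refine natDegree_comp_le.trans ?_
  have : (C r * X).natDegree ≤ 1 := by compute_degree
  nlinarith

theorem self_mem_hyperbolicityCone (hyp : IsHyperbolic h e) : e ∈ hyperbolicityCone h e := by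
  have := add_smul_mem_hyperbolicityCone hyp (zero_mem_hyperbolicityCone hyp) zero_le_one
  simpa using this

/-- Since y is dominated by B e, monotonicity bounds |h(s x + u y + e)| by |h(s x + (u B + 1) e)|,
of degree at most the rank of x in s. -/
theorem natDegree_restrictLine_add_le (hyp : IsHyperbolic h e) {x y : Fin n → ℝ}
    (hx : x ∈ hyperbolicityCone h e) (hy : y ∈ hyperbolicityCone h e) {u : ℝ} (hu : 0 ≤ u) :
    (restrictLine h x (u • y + e)).natDegree ≤ hypRank h e x := by
  obtain ⟨B, hB, hBy⟩ := exists_smul_sub_mem_hyperbolicityCone hyp hy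
  refine le_trans ?_ (natDegree_restrictLine_smul_le hyp x (u * B + 1))
  refine natDegree_le_of_abs_eval_le fun s hs => ?_
  rw [eval_restrictLine, eval_restrictLine, aeval_real, aeval_real]
  have h1 : s • x + (u * B + 1) • e = s • x + (u • y + e) + u • (B • e - y) := by module
  rw [h1]
  refine abs_eval_le_abs_eval_add hyp ?_ (smul_mem_hyperbolicityCone hyp hBy hu)
  exact add_mem_hyperbolicityCone hyp (smul_mem_hyperbolicityCone hyp hx hs.le)
    (add_mem_hyperbolicityCone hyp (smul_mem_hyperbolicityCone hyp hy hu)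
      (self_mem_hyperbolicityCone hyp))

/-- h(s x + u y + e) has degree at most rk y in u for s > 0, and at most rk x in s for u ≥ 0.
Interpolating in u at the nodes 0, …, rk y and then setting u = s gives summands of degree at most
rk x + rk y. -/
theorem hypRank_add_le (hyp : IsHyperbolic h e) {x y : Fin n → ℝ}
    (hx : x ∈ hyperbolicityCone h e) (hy : y ∈ hyperbolicityCone h e) :
    hypRank h e (x + y) ≤ hypRank h e x + hypRank h e y := by
  set v : ℕ → ℝ := fun j => (j : ℝ)
  set N := hypRank h e y + 1 with hN
  have hv : Set.InjOn v (Finset.range N) := fun i _ j _ hij => Nat.cast_injective hij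
  have hG : restrictLine h (x + y) e = ∑ j ∈ Finset.range N,
      restrictLine h x (v j • y + e) * Lagrange.basis (Finset.range N) v j := by
    refine eq_of_eval_eq_of_pos fun s hs => ?_
    have hdeg : (restrictLine h y (s • x + e)).degree < (Finset.range N).card := by
      rw [Finset.card_range]
      refine (degree_le_natDegree).trans_lt ?_
      have := natDegree_restrictLine_add_le hyp hy hx hs.le
      exact_mod_cast Nat.lt_succ_of_le this
    have hint := Lagrange.eq_interpolate hv hdeg
    have := congrArg (eval s) hint
    rw [Lagrange.interpolate_apply, eval_finsetSum, eval_restrictLine, aeval_real] at this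
    rw [eval_restrictLine, aeval_real, eval_finsetSum]
    have h1 : s • (x + y) + e = s • y + (s • x + e) := by module
    rw [h1, this]
    refine Finset.sum_congr rfl fun j _ => ?_
    rw [eval_mul, eval_C, eval_mul, eval_restrictLine, eval_restrictLine, aeval_real, aeval_real]
    congr 2
    abel_nf
  rw [← natDegree_restrictLine_eq_hypRank hyp, hG]
  refine natDegree_sum_le_of_forall_le _ _ fun j hj => natDegree_mul_le.trans ?_
  refine Nat.add_le_add (natDegree_restrictLine_add_le hyp hx hy (Nat.cast_nonneg j)) ?_
  refine natDegree_le_of_degree_le ?_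
  rw [Lagrange.degree_basis hv hj, Finset.card_range, hN, Nat.add_sub_cancel]

/-- The hyperbolic rank is monotone up to scaling. -/
theorem hypRank_le_of_smul_sub_mem (hyp : IsHyperbolic h e) {x w : Fin n → ℝ} {M : ℝ}
    (hw : w ∈ hyperbolicityCone h e) (hM : M • x - w ∈ hyperbolicityCone h e) :
    hypRank h e w ≤ hypRank h e x := by
  refine le_trans ?_ (hypRank_smul_le hyp x M)
  rw [← natDegree_restrictLine_eq_hypRank hyp, ← natDegree_restrictLine_eq_hypRank hyp]
  refine natDegree_le_of_abs_eval_le fun s hs => ?_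
  rw [eval_restrictLine, eval_restrictLine, aeval_real, aeval_real]
  have h1 : s • M • x + e = s • w + e + s • (M • x - w) := by module
  rw [h1]
  exact abs_eval_le_abs_eval_add hyp (add_mem_hyperbolicityCone hyp
    (smul_mem_hyperbolicityCone hyp hw hs.le) (self_mem_hyperbolicityCone hyp))
    (smul_mem_hyperbolicityCone hyp hM hs.le)

end Rank

/-! ### Projections and their differences. -/

theorem isProjection_of_forall {p : Fin n → ℝ} (hp : ∀ t ∈ eigenvalues h e p, t = 0 ∨ t = 1) :
    IsProjection h e p := by
  refine ⟨fun t ht => ?_, hp⟩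
  rcases hp t ht with rfl | rfl <;> norm_num

theorem isProjection_self (hyp : IsHyperbolic h e) : IsProjection h e e := by
  obtain ⟨d, hd⟩ := hyp.homogeneous
  refine isProjection_of_forall fun t ht => Or.inr ?_
  rw [mem_eigenvalues hyp] at ht
  have h1 : t • e - e = (t - 1) • e := by module
  rw [h1, eval_smul hd] at ht
  have := eq_zero_of_pow_eq_zero ((mul_eq_zero.1 ht).resolve_right hyp.eval_ne_zero)
  linarith

theorem IsProjection.self_sub_mem (hyp : IsHyperbolic h e) {p : Fin n → ℝ}
    (hp : IsProjection h e p) : e - p ∈ hyperbolicityCone h e := by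
  rw [mem_hyperbolicityCone_iff hyp]
  intro s hs
  have h1 : s • e + (e - p) = (s + 1) • e + (-1 : ℝ) • p := by module
  rw [h1, eval_smul_add_smul_eq_prod hyp]
  refine mul_ne_zero hyp.eval_ne_zero (Multiset.prod_ne_zero fun h0 => ?_)
  obtain ⟨l, hl, h0⟩ := Multiset.mem_map.1 h0
  rcases hp.2 l hl with rfl | rfl <;> linarith

theorem card_filter_ne_zero_add_card_filter_ne_one {m : Multiset ℝ}
    (hm : ∀ l ∈ m, l = 0 ∨ l = 1) :
    ((m.map fun l => 1 - l).filter fun t => t ≠ 0).card + (m.filter fun t => t ≠ 0).card =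
      m.card := by
  induction m using Multiset.induction_on with
  | empty => simp
  | cons l m ih =>
    have ih := ih fun l hl => hm l (Multiset.mem_cons_of_mem hl)
    rw [Multiset.map_cons]
    rcases hm l (Multiset.mem_cons_self _ _) with rfl | rfl
    · rw [Multiset.filter_cons_of_pos (p := fun t : ℝ => t ≠ 0) _ (by norm_num),
        Multiset.filter_cons_of_neg (p := fun t : ℝ => t ≠ 0) _ (by norm_num), Multiset.card_cons,
        Multiset.card_cons]
      omega
    · rw [Multiset.filter_cons_of_neg (p := fun t : ℝ => t ≠ 0) _ (by norm_num),
        Multiset.filter_cons_of_pos (p := fun t : ℝ => t ≠ 0) _ (by norm_num), Multiset.card_cons,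
        Multiset.card_cons]
      omega

theorem exists_prod_eq_pow_mul_pow {m : Multiset ℝ} (hm : ∀ l ∈ m, l = 0 ∨ l = 1) :
    ∃ k, k + (m.filter fun t => t ≠ 0).card = m.card ∧ ∀ s u : ℝ,
      (m.map fun l => s + u * l).prod = s ^ k * (s + u) ^ (m.filter fun t => t ≠ 0).card := by
  induction m using Multiset.induction_on with
  | empty => exact ⟨0, by simp⟩
  | cons l m ih =>
    obtain ⟨k, hk, hprod⟩ := ih fun l hl => hm l (Multiset.mem_cons_of_mem hl)
    rcases hm l (Multiset.mem_cons_self _ _) with rfl | rfl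
    · refine ⟨k + 1, ?_, fun s u => ?_⟩
      · rw [Multiset.filter_cons_of_neg (p := fun t : ℝ => t ≠ 0) _ (by norm_num),
          Multiset.card_cons]
        omega
      · rw [Multiset.filter_cons_of_neg (p := fun t : ℝ => t ≠ 0) _ (by norm_num),
          Multiset.map_cons, Multiset.prod_cons, hprod]
        ring
    · refine ⟨k, ?_, fun s u => ?_⟩
      · rw [Multiset.filter_cons_of_pos (p := fun t : ℝ => t ≠ 0) _ (by norm_num),
          Multiset.card_cons, Multiset.card_cons]
        omega
      · rw [Multiset.filter_cons_of_pos (p := fun t : ℝ => t ≠ 0) _ (by norm_num),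
          Multiset.map_cons, Multiset.prod_cons, hprod, Multiset.card_cons]
        ring

theorem IsProjection.exists_eval_eq (hyp : IsHyperbolic h e) (hd : h.IsHomogeneous d)
    {p : Fin n → ℝ} (hp : IsProjection h e p) :
    ∃ k, k + hypRank h e p = d ∧ ∀ s t : ℝ, MvPolynomial.eval (s • (e - p) + t • p) h =
      MvPolynomial.eval e h * (s ^ k * t ^ hypRank h e p) := by
  obtain ⟨k, hk, hprod⟩ := exists_prod_eq_pow_mul_pow hp.2
  refine ⟨k, by rw [hypRank, hk, card_eigenvalues hyp hd], fun s t => ?_⟩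
  have h1 : s • (e - p) + t • p = s • e + (t - s) • p := by module
  rw [h1, eval_smul_add_smul_eq_prod hyp, hprod, add_sub_cancel, hypRank]

/-- On vectors dominated by a multiple of a projection `p`, the polynomial `h` splits off a power
of the coordinate along `e - p`. -/
theorem IsProjection.exists_eval_add_eq (hyp : IsHyperbolic h e) (hd : h.IsHomogeneous d)
    {p q : Fin n → ℝ} (hp : IsProjection h e p) (hq : q ∈ hyperbolicityCone h e) {M : ℝ}
    (hM : M • p - q ∈ hyperbolicityCone h e) :
    ∃ k, k + hypRank h e p = d ∧ ∀ s t : ℝ, MvPolynomial.eval (s • (e - p) + (t • p + q)) h =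
      s ^ k * MvPolynomial.eval ((e - p) + (t • p + q)) h := by
  obtain ⟨k, hk, hprod⟩ := hp.exists_eval_eq hyp hd
  have hcompl := hp.self_sub_mem hyp
  have hpos : ∀ t : ℝ, 0 < t → ∀ s : ℝ,
      MvPolynomial.eval (s • (e - p) + (t • p + q)) h =
        s ^ k * MvPolynomial.eval ((e - p) + (t • p + q)) h := by
    intro t ht s
    -- Adding M p - q can only increase |h|, and on the span of e - p and p the polynomial is an
    -- explicit monomial. The growth lemma then makes the dependence on s monomial.
    have hbound : ∀ s : ℝ, 0 < s → |(restrictLine h (e - p) (t • p + q)).eval s| ≤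
        |MvPolynomial.eval e h| * |t + M| ^ hypRank h e p * s ^ k := by
      intro s hs
      have h2 : |MvPolynomial.eval e h| * |t + M| ^ hypRank h e p * s ^ k =
          |MvPolynomial.eval (s • (e - p) + (t + M) • p) h| := by
        rw [hprod, abs_mul, abs_mul, abs_pow, abs_pow, abs_of_pos hs]
        ring
      have h3 : s • (e - p) + (t + M) • p = s • (e - p) + (t • p + q) + (M • p - q) := by module
      rw [h2, h3, eval_restrictLine, aeval_real]
      refine abs_eval_le_abs_eval_add hyp ?_ hM
      exact add_mem_hyperbolicityCone hyp (smul_mem_hyperbolicityCone hyp hcompl hs.le)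
        (add_mem_hyperbolicityCone hyp (smul_mem_hyperbolicityCone hyp hp.1 ht.le) hq)
    have := eq_C_mul_X_pow_of_abs_eval_le k _ hbound s
    rwa [eval_restrictLine, eval_restrictLine, one_smul, aeval_real, aeval_real] at this
  refine ⟨k, hk, fun s t => ?_⟩
  -- Positivity of t kept the vectors in the cone; both sides are polynomials in t, so the identity
  -- extends to all t.
  have hpoly : restrictLine h p (s • (e - p) + q) = C (s ^ k) * restrictLine h p (e - p + q) := by
    refine eq_of_eval_eq_of_pos fun t ht => ?_
    have := hpos t ht s
    rw [eval_mul, eval_C, eval_restrictLine, eval_restrictLine, aeval_real, aeval_real,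
      add_left_comm, this, add_left_comm]
  have := congrArg (eval t) hpoly
  rw [eval_mul, eval_C, eval_restrictLine, eval_restrictLine, aeval_real, aeval_real,
    add_left_comm, add_left_comm _ (e - p)] at this
  exact this

/-- The vectors t e - (p - q) and (t - 1) e + q differ only in the coefficient of e - p, which is t
for one and t - 1 for the other. Splitting off its k-th power relates the two characteristic
polynomials. -/
theorem IsProjection.roots_sub (hyp : IsHyperbolic h e) (hd : h.IsHomogeneous d)
    {p q : Fin n → ℝ} (hp : IsProjection h e p) (hq : q ∈ hyperbolicityCone h e) {M : ℝ}
    (hM : M • p - q ∈ hyperbolicityCone h e) :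
    ∃ k, k + hypRank h e p = d ∧ Multiset.replicate k 1 + eigenvalues h e (p - q) =
      Multiset.replicate k 0 + (eigenvalues h e q).map fun l => 1 - l := by
  obtain ⟨k, hk, heval⟩ := hp.exists_eval_add_eq hyp hd hq hM
  refine ⟨k, hk, ?_⟩
  have hpoly : (X - C 1) ^ k * linePoly h e (p - q) = X ^ k * (C (MvPolynomial.eval e h) *
      (((eigenvalues h e q).map fun l => 1 - l).map fun l => X - C l).prod) := by
    refine Polynomial.funext fun t => ?_
    have h1 : t • e - (p - q) = t • (e - p) + ((t - 1) • p + q) := by module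
    have h2 : (t - 1) • e + q = (t - 1) • (e - p) + ((t - 1) • p + q) := by module
    have h3 : MvPolynomial.eval ((t - 1) • e + q) h = MvPolynomial.eval e h *
        ((eigenvalues h e q).map fun l => t - (1 - l)).prod := by
      rw [eval_add_eq_prod hyp]
      congr 3
      ext l
      ring
    have h4 : MvPolynomial.eval e h * ((eigenvalues h e q).map fun l => t - (1 - l)).prod =
        (t - 1) ^ k * MvPolynomial.eval ((e - p) + ((t - 1) • p + q)) h := by
      rw [← h3, h2, heval]
    rw [eval_mul, eval_linePoly, h1, heval, eval_mul, eval_mul, eval_multiset_prod, eval_C,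
      Multiset.map_map, Multiset.map_map]
    simp only [Function.comp_def, eval_pow, eval_sub, eval_X, eval_C]
    rw [h4]
    ring
  have h5 := congrArg roots hpoly
  have hX : (X - C (1 : ℝ)) ^ k * linePoly h e (p - q) ≠ 0 :=
    mul_ne_zero (pow_ne_zero _ (X_sub_C_ne_zero _)) (linePoly_ne_zero hyp _)
  rw [roots_mul hX, roots_mul (hpoly ▸ hX), roots_C_mul _ hyp.eval_ne_zero,
    roots_multiset_prod_X_sub_C, roots_pow, roots_pow, roots_X_sub_C, roots_X,
    Multiset.nsmul_singleton, Multiset.nsmul_singleton] at h5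
  exact h5

/-- If a projection `q` is dominated by a multiple of a projection `p`, then `p - q` is again a
projection, and its rank is the difference of the ranks. -/
theorem IsProjection.sub (hyp : IsHyperbolic h e) {p q : Fin n → ℝ} (hp : IsProjection h e p)
    (hq : IsProjection h e q) {M : ℝ} (hM : M • p - q ∈ hyperbolicityCone h e) :
    IsProjection h e (p - q) ∧ hypRank h e (p - q) + hypRank h e q = hypRank h e p := by
  obtain ⟨d, hd⟩ := hyp.homogeneous
  obtain ⟨k, hk, hroots⟩ := hp.roots_sub hyp hd hq.1 hM
  constructor
  · refine isProjection_of_forall fun t ht => ?_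
    have h1 : t ∈ Multiset.replicate k 0 + (eigenvalues h e q).map fun l => 1 - l := by
      rw [← hroots]
      exact Multiset.mem_add.2 (Or.inr ht)
    rcases Multiset.mem_add.1 h1 with h1 | h1
    · exact Or.inl (Multiset.eq_of_mem_replicate h1)
    · obtain ⟨l, hl, rfl⟩ := Multiset.mem_map.1 h1
      rcases hq.2 l hl with rfl | rfl <;> norm_num
  · have h1 := congrArg (fun m : Multiset ℝ => (m.filter fun t => t ≠ 0).card) hroots
    simp only [Multiset.filter_add, Multiset.card_add] at h1
    have hone : (Multiset.replicate k (1 : ℝ)).filter (fun t => t ≠ 0) = Multiset.replicate k 1 :=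
      Multiset.filter_eq_self.2 fun t ht => by
        rw [Multiset.eq_of_mem_replicate ht]; exact one_ne_zero
    have hzero : (Multiset.replicate k (0 : ℝ)).filter (fun t => t ≠ 0) = 0 :=
      Multiset.filter_eq_nil.2 fun t ht => by
        rw [Multiset.eq_of_mem_replicate ht]; simp
    rw [hone, hzero, Multiset.card_replicate, Multiset.card_zero, zero_add] at h1
    have h2 := card_filter_ne_zero_add_card_filter_ne_one hq.2
    rw [card_eigenvalues hyp hd] at h2
    simp only [hypRank] at hk ⊢
    omega

/-! ### Modularity and finite length from a rank function. -/

section Order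

/-- A lattice with an antitone involution and a strictly monotone submodular rank function, for
which the ranks of an element and its complement have constant sum, is modular. -/
theorem isModularLattice_of_rank {P : Type*} [Lattice P] (c : P → P) (hanti : Antitone c)
    (hinv : Function.Involutive c) (rk : P → ℕ) (hmono : StrictMono rk)
    (hsub : ∀ x y, rk (x ⊔ y) + rk (x ⊓ y) ≤ rk x + rk y) (D : ℕ)
    (hcompl : ∀ x, rk (c x) + rk x = D) : IsModularLattice P := by
  have hsup : ∀ x y, c x ⊔ c y = c (x ⊓ y) := by
    intro x y
    refine le_antisymm (sup_le (hanti inf_le_left) (hanti inf_le_right)) ?_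
    have h1 : c (c x ⊔ c y) ≤ x ⊓ y :=
      le_inf ((hanti le_sup_left).trans_eq (hinv x)) ((hanti le_sup_right).trans_eq (hinv y))
    simpa only [hinv _] using hanti h1
  have hinf : ∀ x y, c x ⊓ c y = c (x ⊔ y) := by
    intro x y
    have := hsup (c x) (c y)
    rw [hinv, hinv] at this
    rw [this, hinv]
  have hmod : ∀ x y, rk (x ⊔ y) + rk (x ⊓ y) = rk x + rk y := by
    intro x y
    -- Complementation exchanges joins and meets, so submodularity at the complements is the reverse
    -- inequality at x and y.
    have h1 := hsub (c x) (c y)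
    rw [hsup, hinf] at h1
    have h2 := hsub x y
    have h3 := hcompl x
    have h4 := hcompl y
    have h5 := hcompl (x ⊓ y)
    have h6 := hcompl (x ⊔ y)
    omega
  refine ⟨fun {x} y {z} hxz => ?_⟩
  have hle : x ⊔ y ⊓ z ≤ (x ⊔ y) ⊓ z :=
    le_inf (sup_le_sup_left inf_le_left x) (sup_le hxz inf_le_right)
  refine (eq_of_le_of_not_lt hle fun hlt => ?_).ge
  have h1 := hmono hlt
  -- Four instances of the rank identity show that the two sides of the modular law have equal rank,
  -- contradicting strictness.
  have h2 := hmod (x ⊔ y) z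
  have h3 := hmod x (y ⊓ z)
  have h4 := hmod x y
  have h5 := hmod y z
  have h6 : x ⊔ y ⊔ z = y ⊔ z := by
    rw [sup_assoc]
    exact sup_eq_right.2 (hxz.trans le_sup_right)
  have h7 : x ⊓ (y ⊓ z) = x ⊓ y := by
    rw [← inf_assoc]
    exact inf_eq_left.2 (inf_le_left.trans hxz)
  rw [h6] at h2
  rw [h7] at h3
  omega

theorem finiteDimensionalOrder_of_strictMono {P : Type*} [PartialOrder P] [Nonempty P]
    (rk : P → ℕ) (hmono : StrictMono rk) (D : ℕ) (hD : ∀ x, rk x ≤ D) :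
    FiniteDimensionalOrder P := by
  rw [Order.finiteDimensionalOrder_iff_krullDim_ne_bot_and_top]
  refine ⟨Order.krullDim_ne_bot_iff.2 inferInstance, fun htop => ?_⟩
  have h1 : Order.krullDim P ≤ (D : WithBot ℕ∞) := by
    refine iSup_le fun p => ?_
    have := (p.map (fun x => (⟨rk x, Nat.lt_succ_of_le (hD x)⟩ : Fin (D + 1)))
      fun x y hxy => hmono hxy).length_lt_card
    rw [Fintype.card_fin] at this
    exact_mod_cast Nat.le_of_lt_succ this
  rw [htop, top_le_iff] at h1
  have h2 : (D : ℕ∞) = ⊤ := WithBot.coe_injective h1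
  exact ENat.natCast_ne_top D h2

end Order

/-! ### Faces and the elements that generate them. -/

theorem exists_smul_sub_mem_of_mem_intrinsicInterior {F : PointedCone ℝ (Fin n → ℝ)}
    {p y : Fin n → ℝ} (hp : p ∈ intrinsicInterior ℝ (F : Set (Fin n → ℝ))) (hy : y ∈ F) :
    ∃ M : ℝ, M • p - y ∈ F := by
  obtain ⟨p', hp', rfl⟩ := mem_intrinsicInterior.1 hp
  have hyS : y ∈ affineSpan ℝ (F : Set (Fin n → ℝ)) := subset_affineSpan ℝ _ hy
  -- The segment from y to p can be prolonged slightly beyond p inside F; dividing (1 + t) p - t y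
  -- by t gives the multiple M = (1 + t)/t.
  let g : ℝ → affineSpan ℝ (F : Set (Fin n → ℝ)) := fun t =>
    ⟨AffineMap.lineMap (p' : Fin n → ℝ) y (-t), AffineMap.lineMap_mem _ p'.2 hyS⟩
  have hg : Continuous g := by
    refine Continuous.subtype_mk ?_ _
    simp only [AffineMap.lineMap_apply]
    fun_prop
  have hg0 : g 0 = p' := Subtype.ext (by simp [g])
  have hmem : ∀ᶠ t in nhdsWithin (0 : ℝ) (Set.Ioi 0), (g t : Fin n → ℝ) ∈ F := by
    refine Filter.Eventually.filter_mono nhdsWithin_le_nhds ?_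
    have := hg.continuousAt.preimage_mem_nhds (x := 0)
      (by rw [hg0]; exact mem_interior_iff_mem_nhds.1 hp')
    exact this
  obtain ⟨t, ht, ht0⟩ := (hmem.and self_mem_nhdsWithin).exists
  have ht0 : 0 < t := ht0
  refine ⟨(1 + t) / t, ?_⟩
  have h1 := F.smul_mem (inv_nonneg.2 ht0.le) ht
  convert h1 using 1
  have h2 : (g t : Fin n → ℝ) = (1 + t) • (p' : Fin n → ℝ) - t • y := by
    simp only [g, AffineMap.lineMap_apply, vsub_eq_sub, vadd_eq_add]
    module
  rw [h2]
  rw [smul_sub, smul_smul, smul_smul, inv_mul_cancel₀ ht0.ne', one_smul, div_eq_inv_mul]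

/-- The face of the hyperbolicity cone generated by one of its elements `x`. -/
def faceOf (hyp : IsHyperbolic h e) (x : Fin n → ℝ) (hx : x ∈ hyperbolicityCone h e) :
    Faces (hyperbolicityCone h e) where
  val :=
    { carrier := {y | y ∈ hyperbolicityCone h e ∧ ∃ M : ℝ, M • x - y ∈ hyperbolicityCone h e}
      add_mem' := by
        rintro y z ⟨hy, M, hM⟩ ⟨hz, N, hN⟩
        refine ⟨add_mem_hyperbolicityCone hyp hy hz, M + N, ?_⟩
        convert add_mem_hyperbolicityCone hyp hM hN using 1
        module
      zero_mem' := ⟨zero_mem_hyperbolicityCone hyp, 1, by simpa using hx⟩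
      smul_mem' := by
        rintro ⟨c, hc⟩ y ⟨hy, M, hM⟩
        refine ⟨smul_mem_hyperbolicityCone hyp hy hc, c * M, ?_⟩
        convert smul_mem_hyperbolicityCone hyp hM hc using 1
        rw [smul_sub, smul_smul]
        rfl }
  property :=
    { subset := fun y hy => hy.1
      mem_of_le := by
        rintro x' y hx' - hxy ⟨-, M, hM⟩
        refine ⟨hx', M, ?_⟩
        convert add_mem_hyperbolicityCone hyp hM hxy using 1
        abel }

theorem self_mem_faceOf (hyp : IsHyperbolic h e) {x : Fin n → ℝ}
    (hx : x ∈ hyperbolicityCone h e) : x ∈ (faceOf hyp x hx).1 :=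
  ⟨hx, 1, by rw [one_smul, sub_self]; exact zero_mem_hyperbolicityCone hyp⟩

theorem mem_of_smul_sub_mem (hyp : IsHyperbolic h e) {F : Faces (hyperbolicityCone h e)}
    {x y : Fin n → ℝ} (hx : x ∈ F.1) (hy : y ∈ hyperbolicityCone h e) {M : ℝ}
    (hM : M • x - y ∈ hyperbolicityCone h e) : y ∈ F.1 := by
  have hxC := F.2.subset hx
  -- M may be negative, while a face is closed only under nonnegative scaling.
  have hmem : |M| • x ∈ F.1 := F.1.smul_mem (abs_nonneg M) hx
  refine F.2.mem_of_le y (|M| • x) hy (F.2.subset hmem) ?_ hmem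
  have h1 : |M| • x - y = (M • x - y) + (|M| - M) • x := by module
  rw [h1]
  exact add_mem_hyperbolicityCone hyp hM
    (smul_mem_hyperbolicityCone hyp hxC (sub_nonneg.2 (le_abs_self M)))

theorem faceOf_le_iff (hyp : IsHyperbolic h e) {x : Fin n → ℝ}
    {hx : x ∈ hyperbolicityCone h e} {F : Faces (hyperbolicityCone h e)} :
    faceOf hyp x hx ≤ F ↔ x ∈ F.1 := by
  constructor
  · intro hle
    exact hle (self_mem_faceOf hyp hx)
  · rintro hxF y ⟨hy, M, hM⟩
    exact mem_of_smul_sub_mem hyp hxF hy hM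

/-- The lattice of faces of the hyperbolicity cone. -/
@[reducible] def facesLattice (hyp : IsHyperbolic h e) {pr : Faces (hyperbolicityCone h e) → Fin n → ℝ}
    (hmem : ∀ F, pr F ∈ F.1) (hle : ∀ F G, pr F ∈ G.1 → F ≤ G) :
    Lattice (Faces (hyperbolicityCone h e)) :=
  { (inferInstance : PartialOrder (Faces (hyperbolicityCone h e))) with
    -- Each chosen element generates its face, so the sum generates the smallest face containing
    -- both.
    sup := fun F G => faceOf hyp (pr F + pr G)
      (add_mem_hyperbolicityCone hyp (F.2.subset (hmem F)) (G.2.subset (hmem G)))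
    inf := fun F G => ⟨F.1 ⊓ G.1, fun _ hx => F.2.subset hx.1, fun x y hx hy hxy hyF =>
      ⟨F.2.mem_of_le x y hx hy hxy hyF.1, G.2.mem_of_le x y hx hy hxy hyF.2⟩⟩
    le_sup_left := fun F G => hle _ _ ⟨F.2.subset (hmem F), 1, by
      rw [one_smul, add_sub_cancel_left]; exact G.2.subset (hmem G)⟩
    le_sup_right := fun F G => hle _ _ ⟨G.2.subset (hmem G), 1, by
      rw [one_smul, add_sub_cancel_right]; exact F.2.subset (hmem F)⟩
    sup_le := fun F G _ hF hG => (faceOf_le_iff hyp).2 (add_mem (hF (hmem F)) (hG (hmem G)))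
    inf_le_left := fun _ _ _ hx => hx.1
    inf_le_right := fun _ _ _ hx => hx.2
    le_inf := fun _ _ _ hG hK _ hx => ⟨hG hx, hK hx⟩ }

/-- A choice of a projection in each face of the hyperbolicity cone, such that all elements of the
face are dominated by a multiple of it. -/
structure IsProjectionChoice (h : MvPolynomial (Fin n) ℝ) (e : Fin n → ℝ)
    (pr : Faces (hyperbolicityCone h e) → Fin n → ℝ) : Prop where
  mem : ∀ F, pr F ∈ F.1
  isProjection : ∀ F, IsProjection h e (pr F)
  exists_smul_sub_mem : ∀ F, ∀ y ∈ F.1, ∃ M : ℝ, M • pr F - y ∈ hyperbolicityCone h e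

theorem eq_zero_of_mem_neg_mem (lin : linealitySpace (hyperbolicityCone h e) = {0})
    {x : Fin n → ℝ} (hx : x ∈ hyperbolicityCone h e) (hx' : -x ∈ hyperbolicityCone h e) :
    x = 0 := by
  have : x ∈ linealitySpace (hyperbolicityCone h e) := ⟨hx, hx'⟩
  rwa [lin] at this

theorem eq_of_sub_mem_of_sub_mem (lin : linealitySpace (hyperbolicityCone h e) = {0})
    {x y : Fin n → ℝ} (hxy : y - x ∈ hyperbolicityCone h e)
    (hyx : x - y ∈ hyperbolicityCone h e) : x = y := by
  rw [← neg_sub] at hyx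
  exact (sub_eq_zero.1 (eq_zero_of_mem_neg_mem lin hxy hyx)).symm

/-- If all eigenvalues vanish, then -x is in the cone as well, and the cone is pointed. -/
theorem eq_zero_of_hypRank_eq_zero (hyp : IsHyperbolic h e)
    (lin : linealitySpace (hyperbolicityCone h e) = {0}) {x : Fin n → ℝ}
    (hx : x ∈ hyperbolicityCone h e) (hr : hypRank h e x = 0) : x = 0 := by
  refine eq_zero_of_mem_neg_mem lin hx ((mem_hyperbolicityCone_iff hyp).2 fun s hs => ?_)
  have h1 : s • e + -x = s • e + (-1 : ℝ) • x := by module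
  rw [h1, eval_smul_add_smul_eq_prod hyp]
  refine mul_ne_zero hyp.eval_ne_zero (Multiset.prod_ne_zero fun h0 => ?_)
  obtain ⟨l, hl, h0⟩ := Multiset.mem_map.1 h0
  have h2 : l = 0 := by
    by_contra hne
    exact Multiset.filter_eq_nil.1 (Multiset.card_eq_zero.1 hr) l hl hne
  rw [h2] at h0
  linarith

/-! ### The face lattice through its projections. -/

namespace IsProjectionChoice

variable {pr : Faces (hyperbolicityCone h e) → Fin n → ℝ}

theorem mem_cone (hpr : IsProjectionChoice h e pr) (F : Faces (hyperbolicityCone h e)) :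
    pr F ∈ hyperbolicityCone h e :=
  (hpr.isProjection F).1

theorem le_of_mem (hyp : IsHyperbolic h e) (hpr : IsProjectionChoice h e pr)
    (F G : Faces (hyperbolicityCone h e)) (hFG : pr F ∈ G.1) : F ≤ G := fun y hy => by
  obtain ⟨M, hM⟩ := hpr.exists_smul_sub_mem F y hy
  exact mem_of_smul_sub_mem hyp hFG (F.2.subset hy) hM

/-- Domination up to a constant improves to constant 1, because the difference of the two
projections is itself a projection. -/
theorem sub_mem_of_mem (hyp : IsHyperbolic h e) (hpr : IsProjectionChoice h e pr)
    {F : Faces (hyperbolicityCone h e)} {q : Fin n → ℝ} (hq : IsProjection h e q)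
    (hqF : q ∈ F.1) : pr F - q ∈ hyperbolicityCone h e := by
  obtain ⟨M, hM⟩ := hpr.exists_smul_sub_mem F q hqF
  exact ((hpr.isProjection F).sub hyp hq hM).1.1

theorem le_iff (hyp : IsHyperbolic h e) (hpr : IsProjectionChoice h e pr)
    {F G : Faces (hyperbolicityCone h e)} : F ≤ G ↔ pr G - pr F ∈ hyperbolicityCone h e := by
  refine ⟨fun hFG => hpr.sub_mem_of_mem hyp (hpr.isProjection F) (hFG (hpr.mem F)), fun hsub => ?_⟩
  refine hpr.le_of_mem hyp F G (mem_of_smul_sub_mem hyp (hpr.mem G) (hpr.mem_cone F) (M := 1) ?_)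
  rwa [one_smul]

theorem eq_of_pr_eq (hyp : IsHyperbolic h e) (hpr : IsProjectionChoice h e pr)
    {F G : Faces (hyperbolicityCone h e)} (hFG : pr F = pr G) : F = G := by
  refine le_antisymm (hpr.le_of_mem hyp F G ?_) (hpr.le_of_mem hyp G F ?_)
  · rw [hFG]; exact hpr.mem G
  · rw [← hFG]; exact hpr.mem F

/-- Two projections generating the same face dominate each other, hence agree in a pointed cone. -/
theorem pr_faceOf (hyp : IsHyperbolic h e) (lin : linealitySpace (hyperbolicityCone h e) = {0})
    (hpr : IsProjectionChoice h e pr) {q : Fin n → ℝ} (hq : IsProjection h e q) :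
    pr (faceOf hyp q hq.1) = q := by
  refine eq_of_sub_mem_of_sub_mem lin ?_ (hpr.sub_mem_of_mem hyp hq (self_mem_faceOf hyp hq.1))
  obtain ⟨-, M, hM⟩ := hpr.mem (faceOf hyp q hq.1)
  exact (hq.sub hyp (hpr.isProjection _) hM).1.1

theorem sub_isProjection (hyp : IsHyperbolic h e) (hpr : IsProjectionChoice h e pr)
    {F G : Faces (hyperbolicityCone h e)} (hFG : F ≤ G) :
    IsProjection h e (pr G - pr F) ∧
      hypRank h e (pr G - pr F) + hypRank h e (pr F) = hypRank h e (pr G) := by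
  refine (hpr.isProjection G).sub hyp (hpr.isProjection F) (M := 1) ?_
  rw [one_smul]
  exact (hpr.le_iff hyp).1 hFG

theorem strictMono_hypRank (hyp : IsHyperbolic h e)
    (lin : linealitySpace (hyperbolicityCone h e) = {0}) (hpr : IsProjectionChoice h e pr) :
    StrictMono fun F => hypRank h e (pr F) := by
  intro F G hFG
  obtain ⟨hproj, hrank⟩ := hpr.sub_isProjection hyp hFG.le
  rcases Nat.eq_zero_or_pos (hypRank h e (pr G - pr F)) with h0 | h0
  · have := sub_eq_zero.1 (eq_zero_of_hypRank_eq_zero hyp lin hproj.1 h0)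
    exact absurd (hpr.eq_of_pr_eq hyp this) hFG.ne'
  · change hypRank h e (pr F) < hypRank h e (pr G)
    omega

theorem compl_isProjection (hyp : IsHyperbolic h e) (hpr : IsProjectionChoice h e pr)
    (F : Faces (hyperbolicityCone h e)) : IsProjection h e (e - pr F) ∧
      hypRank h e (e - pr F) + hypRank h e (pr F) = hypRank h e e := by
  refine (isProjection_self hyp).sub hyp (hpr.isProjection F) (M := 1) ?_
  rw [one_smul]
  exact (hpr.isProjection F).self_sub_mem hyp

/-- The face complementary to `F`, generated by the complementary projection. -/
def compl (hyp : IsHyperbolic h e) (hpr : IsProjectionChoice h e pr)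
    (F : Faces (hyperbolicityCone h e)) : Faces (hyperbolicityCone h e) :=
  faceOf hyp (e - pr F) (hpr.compl_isProjection hyp F).1.1

theorem pr_compl (hyp : IsHyperbolic h e) (lin : linealitySpace (hyperbolicityCone h e) = {0})
    (hpr : IsProjectionChoice h e pr) (F : Faces (hyperbolicityCone h e)) :
    pr (hpr.compl hyp F) = e - pr F :=
  hpr.pr_faceOf hyp lin (hpr.compl_isProjection hyp F).1

theorem antitone_compl (hyp : IsHyperbolic h e)
    (lin : linealitySpace (hyperbolicityCone h e) = {0}) (hpr : IsProjectionChoice h e pr) :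
    Antitone (hpr.compl hyp) := by
  intro F G hFG
  rw [hpr.le_iff hyp] at hFG ⊢
  rwa [hpr.pr_compl hyp lin, hpr.pr_compl hyp lin, sub_sub_sub_cancel_left]

theorem involutive_compl (hyp : IsHyperbolic h e)
    (lin : linealitySpace (hyperbolicityCone h e) = {0}) (hpr : IsProjectionChoice h e pr) :
    Function.Involutive (hpr.compl hyp) := by
  intro F
  refine hpr.eq_of_pr_eq hyp ?_
  rw [hpr.pr_compl hyp lin, hpr.pr_compl hyp lin, sub_sub_cancel]

/-- Submodularity of the rank, for a common lower bound `Z` of the faces `F` and `G` and a face `S`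
inside the face generated by `F` and `G`. -/
theorem hypRank_add_hypRank_le (hyp : IsHyperbolic h e) (hpr : IsProjectionChoice h e pr)
    {F G Z S : Faces (hyperbolicityCone h e)} (hZF : Z ≤ F) (hZG : Z ≤ G)
    (hS : pr S ∈ (faceOf hyp (pr F + pr G)
      (add_mem_hyperbolicityCone hyp (hpr.mem_cone F) (hpr.mem_cone G))).1) :
    hypRank h e (pr S) + hypRank h e (pr Z) ≤ hypRank h e (pr F) + hypRank h e (pr G) := by
  obtain ⟨hF, hFr⟩ := hpr.sub_isProjection hyp hZF
  obtain ⟨hG, hGr⟩ := hpr.sub_isProjection hyp hZG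
  obtain ⟨hSC, M, hM⟩ := hS
  have h1 := hypRank_le_of_smul_sub_mem hyp hSC hM
  -- The three pieces have ranks at most rk Z, rk F - rk Z and rk G - rk Z.
  have h2 : pr F + pr G = (2 : ℝ) • pr Z + ((pr F - pr Z) + (pr G - pr Z)) := by module
  rw [h2] at h1
  have h3 := hypRank_add_le hyp (smul_mem_hyperbolicityCone hyp (hpr.mem_cone Z) zero_le_two)
    (add_mem_hyperbolicityCone hyp hF.1 hG.1)
  have h4 := hypRank_add_le hyp hF.1 hG.1
  have h5 := hypRank_smul_le hyp (pr Z) 2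
  omega

theorem isModularLattice (hyp : IsHyperbolic h e)
    (lin : linealitySpace (hyperbolicityCone h e) = {0}) (hpr : IsProjectionChoice h e pr) :
    @IsModularLattice _ (facesLattice hyp hpr.mem (hpr.le_of_mem hyp)) := by
  let _ := facesLattice hyp hpr.mem (hpr.le_of_mem hyp)
  refine isModularLattice_of_rank (hpr.compl hyp) (hpr.antitone_compl hyp lin)
    (hpr.involutive_compl hyp lin) (fun F => hypRank h e (pr F))
    (hpr.strictMono_hypRank hyp lin) (fun F G => ?_) (hypRank h e e) fun F => ?_
  · exact hpr.hypRank_add_hypRank_le hyp inf_le_left inf_le_right (hpr.mem (F ⊔ G))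
  · rw [hpr.pr_compl hyp lin]
    exact (hpr.compl_isProjection hyp F).2

theorem finiteDimensionalOrder (hyp : IsHyperbolic h e)
    (lin : linealitySpace (hyperbolicityCone h e) = {0}) (hpr : IsProjectionChoice h e pr) :
    FiniteDimensionalOrder (Faces (hyperbolicityCone h e)) := by
  have : Nonempty (Faces (hyperbolicityCone h e)) :=
    ⟨faceOf hyp e (self_mem_hyperbolicityCone hyp)⟩
  refine finiteDimensionalOrder_of_strictMono _ (hpr.strictMono_hypRank hyp lin) (hypRank h e e)
    fun F => ?_
  have := (hpr.compl_isProjection hyp F).2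
  omega

/-- The least face `{0}` of a pointed hyperbolicity cone. -/
@[reducible] def facesOrderBot (hyp : IsHyperbolic h e)
    (lin : linealitySpace (hyperbolicityCone h e) = {0}) :
    OrderBot (Faces (hyperbolicityCone h e)) where
  bot :=
    { val := ⊥
      property :=
        { subset := by
            rintro x rfl
            exact zero_mem_hyperbolicityCone hyp
          mem_of_le := by
            rintro x y hx - hxy rfl
            rw [zero_sub] at hxy
            exact eq_zero_of_mem_neg_mem lin hx hxy } }
  bot_le := fun F => bot_le (a := F.1)

/-- The three differences add up to e - 2a, so it lies in the cone. An eigenvalue 1 of a would make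
h vanish at e + (e - 2a) = 2(e - a), which the cone criterion forbids. -/
theorem eq_zero_of_sub_mem (hyp : IsHyperbolic h e)
    (lin : linealitySpace (hyperbolicityCone h e) = {0}) {a p q : Fin n → ℝ}
    (ha : IsProjection h e a) (hp : p - q - a ∈ hyperbolicityCone h e)
    (hq : q - a ∈ hyperbolicityCone h e) (hpe : e - p ∈ hyperbolicityCone h e) : a = 0 := by
  have h1 : e - (2 : ℝ) • a ∈ hyperbolicityCone h e := by
    have := add_mem_hyperbolicityCone hyp (add_mem_hyperbolicityCone hyp hp hq) hpe
    convert this using 1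
    module
  refine eq_zero_of_hypRank_eq_zero hyp lin ha.1 ?_
  rw [hypRank, Multiset.card_eq_zero, Multiset.filter_eq_nil]
  intro l hl hne
  obtain rfl := (ha.2 l hl).resolve_left hne
  obtain ⟨d, hd⟩ := hyp.homogeneous
  refine (mem_hyperbolicityCone_iff hyp).1 h1 1 one_pos ?_
  have h2 : (1 : ℝ) • e + (e - (2 : ℝ) • a) = (2 : ℝ) • ((1 : ℝ) • e - a) := by module
  rw [h2, eval_smul hd, (mem_eigenvalues hyp).1 hl, mul_zero]

theorem isAtomistic (hyp : IsHyperbolic h e)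
    (lin : linealitySpace (hyperbolicityCone h e) = {0}) (hpr : IsProjectionChoice h e pr) :
    @IsAtomistic (Faces (hyperbolicityCone h e)) _ (facesOrderBot hyp lin) := by
  let _ := facesOrderBot hyp lin
  let _ := facesLattice hyp hpr.mem (hpr.le_of_mem hyp)
  have hwf : WellFoundedLT (Faces (hyperbolicityCone h e)) :=
    (hpr.strictMono_hypRank hyp lin).wellFoundedLT
  have hatomic : IsAtomic (Faces (hyperbolicityCone h e)) :=
    isAtomic_of_orderBot_wellFounded_lt hwf.wf
  refine ⟨fun F => ⟨{A | IsAtom A ∧ A ≤ F}, ⟨fun A hA => hA.2, fun G hG => ?_⟩, fun A hA => hA.1⟩⟩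
  -- For an upper bound G of the atoms below F, the projection `pr F - pr K` measures the failure of
  -- F ≤ G. An atom below its face would also lie below K, against `eq_zero_of_sub_mem`.
  set K := F ⊓ G with hK
  have hKF : K ≤ F := inf_le_left
  obtain ⟨hproj, -⟩ := hpr.sub_isProjection hyp hKF
  rcases eq_bot_or_exists_atom_le (faceOf hyp (pr F - pr K) hproj.1) with hbot | ⟨A, hA, hAle⟩
  · have h0 : pr F - pr K ∈ (⊥ : Faces (hyperbolicityCone h e)).1 :=
      hbot ▸ self_mem_faceOf hyp hproj.1
    have h1 : pr F = pr K := sub_eq_zero.1 h0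
    exact (hpr.eq_of_pr_eq hyp h1).le.trans inf_le_right
  · exfalso
    have hsub : pr F - pr K - pr A ∈ hyperbolicityCone h e := by
      have := (hpr.le_iff hyp).1 hAle
      rwa [hpr.pr_faceOf hyp lin hproj] at this
    have hAF : A ≤ F := by
      refine (hpr.le_iff hyp).2 ?_
      convert add_mem_hyperbolicityCone hyp hsub (hpr.mem_cone K) using 1
      abel
    have hAK : A ≤ K := le_inf hAF (hG ⟨hA, hAF⟩)
    have h0 := eq_zero_of_sub_mem hyp lin (hpr.isProjection A) hsub ((hpr.le_iff hyp).1 hAK)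
      (hpr.compl_isProjection hyp F).1.1
    refine hA.1 (le_bot_iff.1 (hpr.le_of_mem hyp A ⊥ ?_))
    rw [h0]
    exact zero_mem _

end IsProjectionChoice

end Hyperbolic

end

theorem mainTheorem9 {n : ℕ} (h : MvPolynomial (Fin n) ℝ) (e : Fin n → ℝ)
    (hyp : Hyperbolic.IsHyperbolic h e)
    (lineality : Hyperbolic.linealitySpace (Hyperbolic.hyperbolicityCone h e) = {0})
    (rays : ∀ R S : PointedCone ℝ (Fin n → ℝ),
      Hyperbolic.IsExtremeRay (Hyperbolic.hyperbolicityCone h e) R →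
      Hyperbolic.IsExtremeRay (Hyperbolic.hyperbolicityCone h e) S →
      Hyperbolic.faceRank h e R = Hyperbolic.faceRank h e S)
    (proj : ∀ F : PointedCone ℝ (Fin n → ℝ),
      Hyperbolic.IsFace (Hyperbolic.hyperbolicityCone h e) F →
      ∃ p ∈ intrinsicInterior ℝ (F : Set (Fin n → ℝ)), Hyperbolic.IsProjection h e p) :
    Hyperbolic.IsModularGeometricLattice
      (Hyperbolic.Faces (Hyperbolic.hyperbolicityCone h e)) := by
  choose pr hint hproj using
    fun F : Hyperbolic.Faces (Hyperbolic.hyperbolicityCone h e) => proj F.1 F.2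
  have hpr : Hyperbolic.IsProjectionChoice h e pr :=
    { mem := fun F => intrinsicInterior_subset (hint F)
      isProjection := hproj
      exists_smul_sub_mem := fun F y hy => by
        obtain ⟨M, hM⟩ := Hyperbolic.exists_smul_sub_mem_of_mem_intrinsicInterior (hint F) hy
        exact ⟨M, F.2.subset hM⟩ }
  have hmod := hpr.isModularLattice hyp lineality
  refine ⟨⟨Hyperbolic.facesLattice hyp hpr.mem (hpr.le_of_mem hyp), rfl, ?_, hmod⟩,
    ⟨_, hpr.isAtomistic hyp lineality⟩, hpr.finiteDimensionalOrder hyp lineality⟩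
  let _ := Hyperbolic.facesLattice hyp hpr.mem (hpr.le_of_mem hyp)
  infer_instance
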